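/- Let $M\in\{2,3\}$ and let $\Omega\subset\mathbb{R}^M$ be a bounded domain with Lipschitz-continuous polygonal ($M=2$) or polyhedral ($M=3$) boundary. Let $\{\mathcal{T}_h\}$ be a shape-regular and quasi-uniform family of conforming triangulations of $\overline\Omega$ into triangles ($M=2$) or tetrahedra ($M=3$); that is, there are constants $\sigma,\tau>0$ such that, for every mesh $\mathcal T_h$ of the family and every $K\in\mathcal{T}_h$ with diameter $h_K$, the element $K$ contains a ball of radius at least $h_K/\sigma$, and $h:=\max_{K'\in\mathcal{T}_h}h_{K'}\le \tau h_K$. Let $\mathcal{N}_h$ be the set of nodes (vertices) of $\mathcal{T}_h$, let $Q_h$ be the space of continuous functions $\overline\Omega\to\mathbb{R}$ that are affine on each $K\in\mathcal{T}_h$, let $\boldsymbol{U}_h=(Q_h)^M$ be the corresponding space of vector fields, and let $i_{Q_h}:C^0(\overline\Omega)\to Q_h$ be the nodal interpolation operator. Write $(\cdot,\cdot)$ and $\|\cdot\|$ for the inner product and the norm of $L^2(\Omega)$ (with the Euclidean norm for vectors and matrices), and, for $q_h\in Q_h$, $$\|q_h\|_{(H^1(\Omega)\cap L^\infty(\Omega))'}=\sup_{0\ne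 q\in H^1(\Omega)\cap L^\infty(\Omega)}\frac{(q_h,q)}{\|q\|_{H^1(\Omega)}+\|q\|_{L^\infty(\Omega)}},\qquad \|q\|_{H^1(\Omega)}=\big(\|q\|^2+\|\nabla q\|^2\big)^{1/2}.$$ Then there is a constant $C>0$, independent of $h$ (that is, the same for all meshes of the family), such that for every mesh $\mathcal{T}_h$ of the family and every $\boldsymbol{u}_h\in\boldsymbol{U}_h$ with $|\boldsymbol{u}_h(\boldsymbol{a})|=1$ for all $\boldsymbol{a}\in\mathcal{N}_h$, the following inf-sup condition holds: $$C\,\frac{1}{1+\|\nabla \boldsymbol{u}_h\|}\;\le\;\inf_{q_h\in Q_h\setminus\{0\}}\ \sup_{\boldsymbol{v}_h\in \boldsymbol{U}_h\setminus\{\boldsymbol{0}\}}\frac{\big(q_h,\, i_{Q_h}(\boldsymbol{u}_h\cdot \boldsymbol{v}_h)\big)}{\|q_h\|_{(H^1(\Omega)\cap L^\infty(\Omega))'}\,\big(\|\nabla\boldsymbol{v}_h\|+\|\boldsymbol{v}_h\|_{L^\infty(\Omega)}\big)}.$$ -/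

import Mathlib

open MeasureTheory Set Metric
open scoped ContDiff ENNReal NNReal

noncomputable section

namespace P1FEM

/-- The ambient space `ℝ^M` with its Euclidean norm. -/
abbrev Euc (M : ℕ) : Type := EuclideanSpace ℝ (Fin M)

variable {M : ℕ} {Ω : Set (Euc M)}
variable {F : Type*} [NormedAddCommGroup F] [NormedSpace ℝ F]

/-! ### The domain -/

/-- A bounded domain with Lipschitz-continuous polygonal (polyhedral) boundary. Near every boundary
point, in suitable orthonormal coordinates with vertical direction `e`, the set `Ω` is the region
strictly above the graph of a Lipschitz function `γ` of the horizontal part `y - ⟪e, y⟫ e` of `y`;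
and the boundary is contained in finitely many affine hyperplanes. -/
structure IsPolyhedralLipschitzDomain (Ω : Set (Euc M)) : Prop where
  isOpen : IsOpen Ω
  isConnected : IsConnected Ω
  isBounded : Bornology.IsBounded Ω
  lipschitz : ∀ x ∈ frontier Ω, ∃ (e : Euc M) (r : ℝ) (k : ℝ≥0) (γ : Euc M → ℝ),
    ‖e‖ = 1 ∧ 0 < r ∧ LipschitzWith k γ ∧
      ∀ y ∈ ball x r, (y ∈ Ω ↔ γ (y - (inner ℝ e y) • e) < inner ℝ e y)
  polyhedral : ∃ P : Finset (Euc M × ℝ), (∀ p ∈ P, p.1 ≠ 0) ∧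
    frontier Ω ⊆ ⋃ p ∈ P, {y | inner ℝ p.1 y = p.2}

/-! ### Triangulations -/

/-- A (conforming) triangulation of `closure Ω`: a finite simplicial complex, all of whose faces
are faces of `M`-dimensional simplices, with underlying space `closure Ω`. -/
structure Triangulation (Ω : Set (Euc M)) extends Geometry.SimplicialComplex ℝ (Euc M) where
  finite_faces : faces.Finite
  pure : ∀ s ∈ faces, ∃ t ∈ faces, s ⊆ t ∧ t.card = M + 1
  space_eq : toSimplicialComplex.space = closure Ω

namespace Triangulation

/-- The elements `K` of the triangulation, each given by its set of `M + 1` vertices. -/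
def cells (T : Triangulation Ω) : Set (Finset (Euc M)) := {s ∈ T.faces | s.card = M + 1}

/-- The nodes of the triangulation, i.e. the vertices of its elements. -/
def nodes (T : Triangulation Ω) : Set (Euc M) := T.toSimplicialComplex.vertices

/-- The mesh size `h = max_K h_K`, where `h_K` is the diameter of `K`. -/
def meshSize (T : Triangulation Ω) : ℝ :=
  sSup ((fun s : Finset (Euc M) => diam (convexHull ℝ (s : Set (Euc M)))) '' T.cells)

end Triangulation

/-- Shape regularity: every element `K` of every mesh contains a ball whose radius is at least
`h_K / σ`, with `σ` independent of the element and of the mesh. -/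
def ShapeRegular {ι : Type*} (𝒯 : ι → Triangulation Ω) : Prop :=
  ∃ σ : ℝ, 0 < σ ∧ ∀ i, ∀ s ∈ (𝒯 i).cells, ∃ (x : Euc M) (r : ℝ),
    closedBall x r ⊆ convexHull ℝ (s : Set (Euc M)) ∧
      diam (convexHull ℝ (s : Set (Euc M))) ≤ σ * r

/-- Quasi-uniformity: `h ≤ τ h_K` for every element `K` of every mesh, with `τ` independent of the
element and of the mesh. -/
def QuasiUniform {ι : Type*} (𝒯 : ι → Triangulation Ω) : Prop :=
  ∃ τ : ℝ, 0 < τ ∧ ∀ i, ∀ s ∈ (𝒯 i).cells,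
    (𝒯 i).meshSize ≤ τ * diam (convexHull ℝ (s : Set (Euc M)))

/-! ### The finite element spaces and nodal interpolation -/

/-- The space of continuous functions on `closure Ω` with values in `F` whose restriction to every
element is affine. It is `X_h = Q_h` for `F = ℝ` and the space `U_h` of vector fields for
`F = ℝ^M`. -/
def P1 (T : Triangulation Ω) (F : Type*) [NormedAddCommGroup F] [NormedSpace ℝ F] :
    Submodule ℝ C(closure Ω, F) where
  carrier := {v | ∀ s ∈ T.cells, ∃ A : Euc M →ᵃ[ℝ] F,
    ∀ x : closure Ω, (x : Euc M) ∈ convexHull ℝ (s : Set (Euc M)) → v x = A x}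
  zero_mem' := fun s _ => ⟨0, fun x _ => by simp⟩
  add_mem' := by
    intro v w hv hw s hs
    obtain ⟨A, hA⟩ := hv s hs
    obtain ⟨B, hB⟩ := hw s hs
    exact ⟨A + B, fun x hx => by simp [hA x hx, hB x hx]⟩
  smul_mem' := by
    intro c v hv s hs
    obtain ⟨A, hA⟩ := hv s hs
    exact ⟨c • A, fun x hx => by simp [hA x hx]⟩

/-- An affine map with prescribed values at the `M + 1` vertices of a simplex. -/
lemma exists_affine_eq (T : Triangulation Ω) {s : Finset (Euc M)} (hs : s ∈ T.cells)
    (g : Euc M → F) : ∃ A : Euc M →ᵃ[ℝ] F, ∀ a ∈ s, A a = g a := by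
  classical
  have hind := T.indep hs.1
  have htop : affineSpan ℝ (range ((↑) : s → Euc M)) = ⊤ := by
    rw [hind.affineSpan_eq_top_iff_card_eq_finrank_add_one]
    simp [hs.2]
  let b : AffineBasis s ℝ (Euc M) := ⟨(↑), hind, htop⟩
  refine ⟨∑ i : s, (LinearMap.toSpanSingleton ℝ F (g i)).toAffineMap.comp (b.coord i), ?_⟩
  intro a ha
  have hb : ∀ i : s, b.coord i a = if i = ⟨a, ha⟩ then 1 else 0 := fun i =>
    b.coord_apply i ⟨a, ha⟩
  have hsum : ∀ (t : Finset s) (f : s → (Euc M →ᵃ[ℝ] F)) (x : Euc M),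
      (∑ i ∈ t, f i) x = ∑ i ∈ t, f i x := by
    intro t f x
    induction t using Finset.induction_on with
    | empty => simp
    | insert i t hi ih => simp [Finset.sum_insert hi, ih]
  rw [hsum]
  simp [hb]

/-- Every continuous function on `closure Ω` has a nodal interpolant. -/
theorem exists_interpolant (T : Triangulation Ω) (g : C(closure Ω, F)) :
    ∃ w ∈ P1 T F, ∀ a : closure Ω, (a : Euc M) ∈ T.nodes → w a = g a := by
  classical
  have hcover : ∀ x : closure Ω, ∃ s ∈ T.cells, (x : Euc M) ∈ convexHull ℝ (s : Set (Euc M)) := by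
    rintro ⟨x, hx⟩
    rw [← T.space_eq, Geometry.SimplicialComplex.mem_space_iff] at hx
    obtain ⟨s, hs, hxs⟩ := hx
    obtain ⟨t, ht, hst, hc⟩ := T.pure s hs
    exact ⟨t, ⟨ht, hc⟩, convexHull_mono (Finset.coe_subset.2 hst) hxs⟩
  let G : Euc M → F := Function.extend Subtype.val g 0
  have hG : ∀ a : closure Ω, G a = g a := fun a => Subtype.val_injective.extend_apply g 0 a
  have hex : ∀ s : T.cells, ∃ A : Euc M →ᵃ[ℝ] F, ∀ a ∈ s.1, A a = G a :=
    fun s => exists_affine_eq T s.2 G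
  choose A hA using hex
  choose c hc hxc using hcover
  have hagree : ∀ (s t : T.cells) (x : Euc M), x ∈ convexHull ℝ (s.1 : Set (Euc M)) →
      x ∈ convexHull ℝ (t.1 : Set (Euc M)) → A s x = A t x := by
    intro s t x hxs hxt
    have hx := T.inter_subset_convexHull s.2.1 t.2.1 ⟨hxs, hxt⟩
    have hconv : Convex ℝ {y | A s y = A t y} := by
      intro y hy z hz p q _ _ hpq
      have h1 := Convex.combo_affine_apply (f := A s) (x := y) (y := z) hpq
      have h2 := Convex.combo_affine_apply (f := A t) (x := y) (y := z) hpq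
      simp only [mem_ofPred_eq] at hy hz ⊢
      rw [h1, h2, hy, hz]
    refine convexHull_min ?_ hconv hx
    intro a ha
    simp only [mem_ofPred_eq]
    rw [hA s a (by simpa using ha.1), hA t a (by simpa using ha.2)]
  let w : closure Ω → F := fun x => A ⟨c x, hc x⟩ x
  have hw : ∀ (s : T.cells) (x : closure Ω), (x : Euc M) ∈ convexHull ℝ (s.1 : Set (Euc M)) →
      w x = A s x := fun s x hx => hagree _ s x (hxc x) hx
  have hcont : Continuous w := by
    have : Finite T.cells := (T.finite_faces.subset (fun s hs => hs.1)).to_subtype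
    refine LocallyFinite.continuous
      (f := fun s : T.cells => {x : closure Ω | (x : Euc M) ∈ convexHull ℝ (s.1 : Set (Euc M))})
      (locallyFinite_of_finite _) ?_ ?_ ?_
    · exact eq_univ_of_forall fun x => mem_iUnion.2 ⟨⟨c x, hc x⟩, hxc x⟩
    · intro s
      exact (s.1.finite_toSet.isClosed_convexHull ℝ).preimage continuous_subtype_val
    · intro s
      have : Continuous (fun x : closure Ω => A s x) :=
        ((A s).continuous_of_finiteDimensional).comp continuous_subtype_val
      exact this.continuousOn.congr fun x hx => hw s x hx
  refine ⟨⟨w, hcont⟩, fun s hs => ⟨A ⟨s, hs⟩, fun x hx => hw ⟨s, hs⟩ x hx⟩, ?_⟩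
  intro a ha
  obtain ⟨t, ht, hst, hct⟩ := T.pure _ ha
  have hat : (a : Euc M) ∈ t := hst (by simp)
  change w a = g a
  rw [hw ⟨t, ht, hct⟩ a (subset_convexHull ℝ _ (by simpa using hat)), hA ⟨t, ht, hct⟩ a hat, hG]

/-- A finite element function is determined by its nodal values. -/
theorem P1_ext (T : Triangulation Ω) {v w : C(closure Ω, F)} (hv : v ∈ P1 T F) (hw : w ∈ P1 T F)
    (h : ∀ a : closure Ω, (a : Euc M) ∈ T.nodes → v a = w a) : v = w := by
  ext x
  have hx : (x : Euc M) ∈ T.toSimplicialComplex.space := by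
    rw [T.space_eq]
    exact x.2
  rw [Geometry.SimplicialComplex.mem_space_iff] at hx
  obtain ⟨s, hs, hxs⟩ := hx
  obtain ⟨t, ht, hst, hc⟩ := T.pure s hs
  have hxt := convexHull_mono (Finset.coe_subset.2 hst) hxs
  obtain ⟨A, hA⟩ := hv t ⟨ht, hc⟩
  obtain ⟨B, hB⟩ := hw t ⟨ht, hc⟩
  have hconv : Convex ℝ {y | A y = B y} := by
    intro y hy z hz p q _ _ hpq
    have h1 := Convex.combo_affine_apply (f := A) (x := y) (y := z) hpq
    have h2 := Convex.combo_affine_apply (f := B) (x := y) (y := z) hpq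
    simp only [mem_ofPred_eq] at hy hz ⊢
    rw [h1, h2, hy, hz]
  have hAB : A x = B x := by
    refine convexHull_min ?_ hconv hxt
    intro a ha
    have haΩ : a ∈ closure Ω := by
      rw [← T.space_eq]
      exact T.toSimplicialComplex.subset_space ht ha
    have hac : a ∈ convexHull ℝ (t : Set (Euc M)) := subset_convexHull ℝ _ ha
    have han : a ∈ T.nodes :=
      T.down_closed ht (Finset.singleton_subset_iff.2 ha) (Finset.singleton_nonempty a)
    have e := h ⟨a, haΩ⟩ han
    rw [hA ⟨a, haΩ⟩ hac, hB ⟨a, haΩ⟩ hac] at e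
    exact e
  rw [hA x hxt, hB x hxt, hAB]

/-- The nodal interpolation operator: the unique element of the finite element space that takes
the same values at the nodes. -/
def nodalInterp (T : Triangulation Ω) (g : C(closure Ω, F)) : C(closure Ω, F) :=
  (exists_interpolant T g).choose

theorem nodalInterp_mem (T : Triangulation Ω) (g : C(closure Ω, F)) : nodalInterp T g ∈ P1 T F :=
  (exists_interpolant T g).choose_spec.1

theorem nodalInterp_apply (T : Triangulation Ω) (g : C(closure Ω, F)) (a : closure Ω)
    (ha : (a : Euc M) ∈ T.nodes) : nodalInterp T g a = g a :=
  (exists_interpolant T g).choose_spec.2 a ha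

/-! ### Norms and inner products -/

/-- Extension by zero of a function on `closure Ω`, so that it can be integrated and
differentiated in `Ω`. -/
def zeroExt (v : C(closure Ω, F)) : Euc M → F := Function.extend Subtype.val v 0

/-- The norm of `L²(Ω)`. -/
def l2Norm (Ω : Set (Euc M)) (f : Euc M → F) : ℝ := (eLpNorm f 2 (volume.restrict Ω)).toReal

/-- The norm of `L^∞(Ω)`. -/
def linfNorm (Ω : Set (Euc M)) (f : Euc M → F) : ℝ := (eLpNorm f ∞ (volume.restrict Ω)).toReal

/-- The inner product of `L²(Ω)`. -/
def l2Inner (Ω : Set (Euc M)) (f g : Euc M → ℝ) : ℝ := ∫ x in Ω, f x * g x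

/-- `‖∇v‖` in `L²(Ω)` for a finite element function `v`, with the Euclidean (Frobenius) norm of
the gradient. A finite element function is smooth in the interior of every element, hence almost
everywhere in `Ω`, and as it is continuous its gradient there is also its distributional
gradient. -/
def gradNorm (v : C(closure Ω, F)) : ℝ :=
  l2Norm Ω fun x =>
    Real.sqrt (∑ j : Fin M, ‖fderiv ℝ (zeroExt v) x (EuclideanSpace.single j (1 : ℝ))‖ ^ 2)

/-- The pointwise scalar product of two vector fields. -/
def dot (u v : C(closure Ω, Euc M)) : C(closure Ω, ℝ) where
  toFun x := inner ℝ (u x) (v x)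
  continuous_toFun := u.continuous.inner v.continuous

/-- `G` is the distributional gradient of `f` in `Ω`. -/
def IsWeakGradient (Ω : Set (Euc M)) (f : Euc M → ℝ) (G : Euc M → Euc M) : Prop :=
  ∀ φ : Euc M → ℝ, ContDiff ℝ ∞ φ → HasCompactSupport φ → tsupport φ ⊆ Ω → ∀ e : Euc M,
    ∫ x in Ω, f x * fderiv ℝ φ x e = - ∫ x in Ω, inner ℝ (G x) e * φ x

/-- `f` belongs to `H¹(Ω) ∩ L^∞(Ω)` and has distributional gradient `G`. -/
structure MemH1Linf (Ω : Set (Euc M)) (f : Euc M → ℝ) (G : Euc M → Euc M) : Prop where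
  memLp_two : MemLp f 2 (volume.restrict Ω)
  memLp_top : MemLp f ∞ (volume.restrict Ω)
  memLp_grad : MemLp G 2 (volume.restrict Ω)
  isWeakGradient : IsWeakGradient Ω f G

/-- The norm `‖f‖_{H¹(Ω)} + ‖f‖_{L^∞(Ω)}` of a function `f` in `H¹(Ω) ∩ L^∞(Ω)` with distributional
gradient `G`. -/
def h1LinfNorm (Ω : Set (Euc M)) (f : Euc M → ℝ) (G : Euc M → Euc M) : ℝ :=
  Real.sqrt (l2Norm Ω f ^ 2 + l2Norm Ω G ^ 2) + linfNorm Ω f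

/-- The norm of a function `q`, acting through the `L²(Ω)` inner product, in the dual space of
`H¹(Ω) ∩ L^∞(Ω)`. -/
def dualNorm (Ω : Set (Euc M)) (q : Euc M → ℝ) : ℝ :=
  sSup {r | ∃ (f : Euc M → ℝ) (G : Euc M → Euc M),
    MemH1Linf Ω f G ∧ h1LinfNorm Ω f G ≤ 1 ∧ r = |l2Inner Ω q f|}

end P1FEM

end

/-!
The inf-sup condition reduces to the stability of the `L²` projection `w` onto the scalar finite
element space, simultaneously in `H¹` and in `L^∞`. Let `f` be a function in the unit ball of
`H¹ ∩ L^∞` that almost attains the dual norm of `q_h`, let `w` be its projection and let `v_h` be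
the nodal interpolant of `w u_h`. As `u_h` has unit length at the nodes, the interpolant of
`u_h · v_h` is `w`, and so `(q_h, i(u_h · v_h)) = (q_h, w) = (q_h, f)`. The nodal values give
`‖v_h‖_∞ ≤ ‖w‖_∞` and, by the product rule for differences of nodal values,
`‖∇v_h‖ ≤ C (‖∇w‖ + ‖w‖_∞ ‖∇u_h‖)`. This is `exists_test_field`.

For the `H¹` bound, the gradient of a finite element function is equivalent, up to the mesh size, to
the jumps of its nodal values (`jumpEnergy_le`, `gradNorm_sq_le`), and the jumps of `w` are
controlled by the `L²` distance of `f` to its averages over balls around the nodes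
(`jumpEnergy_l2_projection_le`). That distance is at most `C h ‖f‖_{H¹}`
(`exists_nodal_average_bound`) because the `L²` modulus of continuity of an `H¹` function on a
Lipschitz domain is linear (`IsPolyhedralLipschitzDomain.exists_translate_bound`): where the
segment between two points leaves the domain, both points are first moved along the vertical
direction of the graph. Neither extension operators nor the combinatorics of the mesh enter.

For the `L^∞` bound (`exists_l2_projection_sup_bound`), the equation of the projection is tested
with the nodal values of `w` multiplied by a weight that decays polynomially away from a given node.
On the scale of the mesh the weight varies slowly, so the mass matrix stays coercive after
conjugation with it, and the squared weights sum up to a constant.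
-/

namespace P1FEM

section

variable {M : ℕ} {Ω : Set (Euc M)}

/-! ### Translates of weakly differentiable functions -/

/-- The Cauchy-Schwarz inequality against the constant function `1`. -/
lemma enorm_integral_sq_le {α : Type*} [MeasurableSpace α] {μ : Measure α}
    {F : Type*} [NormedAddCommGroup F] [NormedSpace ℝ F] {g : α → F}
    (hg : AEStronglyMeasurable g μ) :
    ‖∫ x, g x ∂μ‖ₑ ^ 2 ≤ μ univ * ∫⁻ x, ‖g x‖ₑ ^ 2 ∂μ := by
  have h1 := ENNReal.lintegral_mul_le_Lp_mul_Lq μ Real.HolderConjugate.two_two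
    (f := fun x => ‖g x‖ₑ) (g := fun _ => 1) hg.enorm aemeasurable_const
  simp only [Pi.mul_apply, mul_one, ENNReal.one_rpow, lintegral_const, one_mul] at h1
  have h2 := (enorm_integral_le_lintegral_enorm (μ := μ) g).trans h1
  have h3 : ∀ a : ℝ≥0∞, (a ^ (1 / 2 : ℝ)) ^ 2 = a := fun a => by
    rw [← ENNReal.rpow_natCast, ← ENNReal.rpow_mul]; norm_num
  calc ‖∫ x, g x ∂μ‖ₑ ^ 2
      ≤ ((∫⁻ x, ‖g x‖ₑ ^ (2 : ℝ) ∂μ) ^ (1 / 2 : ℝ) * μ univ ^ (1 / 2 : ℝ)) ^ 2 :=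
        pow_le_pow_left₀ zero_le h2 2
    _ = μ univ * ∫⁻ x, ‖g x‖ₑ ^ 2 ∂μ := by
        rw [mul_pow, h3, h3, mul_comm]
        congr 2
        ext x
        exact_mod_cast ENNReal.rpow_natCast _ 2

/-- The points from which the whole segment in direction `v` stays in `Ω`. -/
def segDom (Ω : Set (Euc M)) (v : Euc M) : Set (Euc M) :=
  {x | ∀ t ∈ Icc (0 : ℝ) 1, x + t • v ∈ Ω}

lemma isOpen_segDom (hΩ : IsOpen Ω) (v : Euc M) : IsOpen (segDom Ω v) := by
  rw [isOpen_iff_mem_nhds]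
  intro x hx
  refine (isCompact_Icc (a := (0 : ℝ)) (b := 1)).eventually_forall_of_forall_eventually
    (P := fun x t => x + t • v ∈ Ω) fun t ht => ?_
  have hc : Continuous fun z : Euc M × ℝ => z.1 + z.2 • v := by fun_prop
  exact hc.continuousAt.eventually (hΩ.mem_nhds (hx t ht))

lemma integrable_comp_add_smul {g : Euc M → ℝ} (hg : StronglyMeasurable g)
    (hgi : Integrable g) (v : Euc M) :
    Integrable (fun p : Euc M × ℝ => g (p.1 + p.2 • v))
      (volume.prod (volume.restrict (Ioc (0 : ℝ) 1))) := by
  have hm : Measurable fun p : Euc M × ℝ => p.1 + p.2 • v := by fun_prop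
  rw [integrable_prod_iff' (f := fun p : Euc M × ℝ => g (p.1 + p.2 • v))
    (hg.comp_measurable hm).aestronglyMeasurable]
  refine ⟨ae_of_all _ fun t => hgi.comp_add_right (t • v), ?_⟩
  have : (fun t : ℝ => ∫ x : Euc M, ‖g (x + t • v)‖) = fun _ => ∫ x, ‖g x‖ := by
    ext t
    exact integral_add_right_eq_self (fun x => ‖g x‖) (t • v)
  simp only [this]
  exact integrable_const _

/-- The fundamental theorem of calculus along the direction `v`, for a function with a weak
gradient, at almost every point whose segment in direction `v` stays in `Ω`. It is tested against
smooth functions, for which it is an integration by parts. -/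
lemma ae_translate_sub_eq (hΩ : IsOpen Ω) {f : Euc M → ℝ} {G : Euc M → Euc M}
    (hfi : Integrable f) (hG : StronglyMeasurable G)
    (hGi : Integrable G) (hw : IsWeakGradient Ω f G) (v : Euc M) :
    ∀ᵐ x, x ∈ segDom Ω v →
      f (x + v) - f x = ∫ t in Ioc (0 : ℝ) 1, inner ℝ (G (x + t • v)) v := by
  set g : Euc M → ℝ := fun x => inner ℝ (G x) v with hg
  have hgm : StronglyMeasurable g := hG.inner stronglyMeasurable_const
  have hgi : Integrable g := hGi.inner_const v
  have hI := integrable_comp_add_smul hgm hgi v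
  have hint : Integrable fun x => ∫ t in Ioc (0 : ℝ) 1, g (x + t • v) := hI.integral_prod_left
  have hdi : Integrable fun x => f (x + v) - f x := (hfi.comp_add_right v).sub hfi
  have key := (isOpen_segDom hΩ v).ae_eq_zero_of_integral_contDiff_smul_eq_zero
    (μ := volume) (f := fun x => (f (x + v) - f x) - ∫ t in Ioc (0 : ℝ) 1, g (x + t • v))
    ((hdi.sub hint).locallyIntegrable.locallyIntegrableOn _) ?_
  · filter_upwards [key] with x hx hxW
    exact sub_eq_zero.1 (hx hxW)
  intro φ hφ hφc hφs
  have hφcont : Continuous φ := hφ.continuous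
  obtain ⟨Cφ, hCφ⟩ := hφc.exists_bound_of_continuous hφcont
  have hdφ : Continuous fun x => fderiv ℝ φ x v :=
    (hφ.continuous_fderiv (by simp)).clm_apply continuous_const
  have hdφc : HasCompactSupport fun x => fderiv ℝ φ x v := by
    exact hφc.fderiv_apply (𝕜 := ℝ) v
  obtain ⟨Dφ, hDφ⟩ := hdφc.exists_bound_of_continuous hdφ
  -- a smooth function bounded by a constant is an admissible factor
  have hmul : ∀ {k : Euc M → ℝ}, Integrable k → Integrable fun x => φ x * k x := fun {k} hk =>
    hk.bdd_mul hφcont.aestronglyMeasurable (ae_of_all _ hCφ)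
  -- the left-hand side, moved onto the test function
  have hL : ∫ x, φ x * (f (x + v) - f x) = - ∫ y, f y * ∫ t in Ioc (0 : ℝ) 1,
      fderiv ℝ φ (y - t • v) v := by
    have e1 : ∫ x, φ x * f (x + v) = ∫ y, φ (y - v) * f y := by
      rw [← integral_add_right_eq_self (fun y => φ (y - v) * f y) v]
      simp
    have i1 : Integrable fun y => φ (y - v) * f y :=
      hfi.bdd_mul (hφcont.comp (continuous_id.sub continuous_const)).aestronglyMeasurable
        (ae_of_all _ fun y => hCφ (y - v))
    have e2 : ∀ y, φ (y - v) - φ y = - ∫ t in Ioc (0 : ℝ) 1, fderiv ℝ φ (y - t • v) v := by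
      intro y
      rw [← intervalIntegral.integral_of_le zero_le_one]
      have hd : ∀ t : ℝ, HasDerivAt (fun t : ℝ => φ (y - t • v)) (-(fderiv ℝ φ (y - t • v) v)) t := by
        intro t
        have h1 : HasFDerivAt φ (fderiv ℝ φ (y - t • v)) (y - t • v) :=
          (hφ.differentiable (by simp) _).hasFDerivAt
        have h2 : HasDerivAt (fun t : ℝ => y - t • v) (-v) t := by
          simpa using ((hasDerivAt_id t).smul_const v).const_sub y
        rw [← map_neg]
        exact h1.comp_hasDerivAt t h2
      have hc : Continuous fun t : ℝ => fderiv ℝ φ (y - t • v) v :=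
        hdφ.comp (continuous_const.sub (continuous_id.smul continuous_const))
      have := intervalIntegral.integral_eq_sub_of_hasDerivAt (fun t _ => hd t)
        ((hc.neg).intervalIntegrable 0 1)
      simp only [intervalIntegral.integral_neg, one_smul, zero_smul, sub_zero] at this
      linarith
    calc ∫ x, φ x * (f (x + v) - f x) = (∫ x, φ x * f (x + v)) - ∫ x, φ x * f x := by
          rw [← integral_sub (hmul (hfi.comp_add_right v)) (hmul hfi)]
          simp only [mul_sub]
      _ = ∫ y, (φ (y - v) * f y - φ y * f y) := by
          rw [e1, ← integral_sub i1 (hmul hfi)]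
      _ = _ := by
          rw [← integral_neg]
          congr 1
          ext y
          rw [← sub_mul, e2 y]
          ring
  have hI1 : Integrable (fun p : Euc M × ℝ => f p.1 * fderiv ℝ φ (p.1 - p.2 • v) v)
      (volume.prod (volume.restrict (Ioc (0 : ℝ) 1))) := by
    have h1 : Integrable (fun p : Euc M × ℝ => f p.1)
        (volume.prod (volume.restrict (Ioc (0 : ℝ) 1))) := hfi.comp_fst _
    refine h1.mul_bdd (c := Dφ) ?_ (ae_of_all _ fun p => hDφ _)
    exact (hdφ.comp (by fun_prop : Continuous fun p : Euc M × ℝ => p.1 - p.2 • v)).aestronglyMeasurable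
  have hI2 : Integrable (fun p : Euc M × ℝ => φ p.1 * g (p.1 + p.2 • v))
      (volume.prod (volume.restrict (Ioc (0 : ℝ) 1))) := by
    refine hI.bdd_mul (c := Cφ) ?_ (ae_of_all _ fun p => hCφ _)
    exact (hφcont.comp continuous_fst).aestronglyMeasurable
  -- the weak gradient tested against a translate of the test function
  have hweak : ∀ t ∈ Ioc (0 : ℝ) 1,
      ∫ y, f y * fderiv ℝ φ (y - t • v) v = - ∫ x, φ x * g (x + t • v) := by
    intro t ht
    set ψ : Euc M → ℝ := fun y => φ (y - t • v) with hψ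
    have hψd : ContDiff ℝ ∞ ψ := hφ.comp (contDiff_id.sub contDiff_const)
    have hψc : HasCompactSupport ψ := by
      have := hφc.comp_homeomorph (Homeomorph.addRight (-(t • v)))
      simpa [hψ, Function.comp_def, sub_eq_add_neg] using this
    have hψs : tsupport ψ ⊆ Ω := by
      intro y hy
      have : y - t • v ∈ tsupport φ := by
        have h := tsupport_comp_subset_preimage φ
          (f := fun y : Euc M => y - t • v) (by fun_prop) hy
        exact h
      have := hφs this t ⟨ht.1.le, ht.2⟩
      simpa using this
    have hfd : ∀ y, fderiv ℝ ψ y = fderiv ℝ φ (y - t • v) := fun y => by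
      simp only [hψ, sub_eq_add_neg, fderiv_comp_add_right]
    have h := hw ψ hψd hψc hψs v
    rw [setIntegral_eq_integral_of_forall_compl_eq_zero,
      setIntegral_eq_integral_of_forall_compl_eq_zero] at h
    · simp only [hfd] at h
      rw [h, ← integral_add_right_eq_self (fun x => inner ℝ (G x) v * ψ x) (t • v)]
      congr 1
      congr 1
      ext x
      simp [hψ, hg, mul_comm]
    · intro x hx
      have : ψ x = 0 := image_eq_zero_of_notMem_tsupport fun h => hx (hψs h)
      simp [this]
    · intro x hx
      have hx' : x ∉ tsupport ψ := fun h => hx (hψs h)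
      have : fderiv ℝ ψ x = 0 := by
        by_contra hne
        exact hx' (support_fderiv_subset ℝ hne)
      simp [this]
  simp only [smul_eq_mul, mul_sub (φ _)  _ (∫ t in Ioc (0 : ℝ) 1, g (_ + t • v))]
  rw [integral_sub (hmul hdi) (hmul hint), hL, sub_eq_zero]
  calc - ∫ y, f y * ∫ t in Ioc (0 : ℝ) 1, fderiv ℝ φ (y - t • v) v
      = - ∫ y, ∫ t in Ioc (0 : ℝ) 1, f y * fderiv ℝ φ (y - t • v) v := by
        simp only [integral_const_mul]
    _ = - ∫ t in Ioc (0 : ℝ) 1, ∫ y, f y * fderiv ℝ φ (y - t • v) v := by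
        rw [integral_integral_swap hI1]
    _ = - ∫ t in Ioc (0 : ℝ) 1, - ∫ x, φ x * g (x + t • v) := by
        rw [setIntegral_congr_fun measurableSet_Ioc hweak]
    _ = ∫ t in Ioc (0 : ℝ) 1, ∫ x, φ x * g (x + t • v) := by rw [integral_neg, neg_neg]
    _ = ∫ x, ∫ t in Ioc (0 : ℝ) 1, φ x * g (x + t • v) := by
        rw [integral_integral_swap (f := fun x t => φ x * g (x + t • v)) hI2]
    _ = ∫ x, φ x * ∫ t in Ioc (0 : ℝ) 1, g (x + t • v) := by
        simp only [integral_const_mul]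

/-- The difference of a function and its translate by `v` is controlled in `L²`, over the points
whose segment in direction `v` stays in `Ω`, by `|v|` times the norm of the weak gradient. -/
lemma lintegral_translate_sub_sq_le (hΩ : IsOpen Ω) {f : Euc M → ℝ} {G : Euc M → Euc M}
    (hfi : Integrable f) (hG : StronglyMeasurable G)
    (hGi : Integrable G) (hw : IsWeakGradient Ω f G) (v : Euc M) {E : Set (Euc M)}
    (hE : E ⊆ segDom Ω v) :
    ∫⁻ x in E, ‖f (x + v) - f x‖ₑ ^ 2 ≤ ‖v‖ₑ ^ 2 * ∫⁻ x, ‖G x‖ₑ ^ 2 := by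
  have hm : Measurable fun p : Euc M × ℝ => p.1 + p.2 • v := by fun_prop
  have hGm : Measurable fun p : Euc M × ℝ => ‖G (p.1 + p.2 • v)‖ₑ ^ 2 * ‖v‖ₑ ^ 2 :=
    ((hG.comp_measurable hm).enorm.pow_const 2).mul_const _
  calc ∫⁻ x in E, ‖f (x + v) - f x‖ₑ ^ 2
      ≤ ∫⁻ x in segDom Ω v, ‖f (x + v) - f x‖ₑ ^ 2 := lintegral_mono_set hE
    _ ≤ ∫⁻ x in segDom Ω v, ∫⁻ t in Ioc (0 : ℝ) 1, ‖G (x + t • v)‖ₑ ^ 2 * ‖v‖ₑ ^ 2 := by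
        refine setLIntegral_mono_ae' (isOpen_segDom hΩ v).measurableSet ?_
        filter_upwards [ae_translate_sub_eq hΩ hfi hG hGi hw v] with x hx hxW
        rw [hx hxW]
        have hmx : Measurable fun t : ℝ => x + t • v := by fun_prop
        refine (enorm_integral_sq_le
          ((hG.comp_measurable hmx).inner stronglyMeasurable_const).aestronglyMeasurable).trans ?_
        simp only [Measure.restrict_apply_univ, Real.volume_Ioc, sub_zero, ENNReal.ofReal_one,
          one_mul]
        refine lintegral_mono fun t => ?_
        rw [← mul_pow]
        refine pow_le_pow_left₀ zero_le ?_ 2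
        rw [enorm_eq_nnnorm, enorm_eq_nnnorm, enorm_eq_nnnorm, ← ENNReal.coe_mul,
          ENNReal.coe_le_coe]
        exact nnnorm_inner_le_nnnorm (G (x + t • v)) v
    _ ≤ ∫⁻ x, ∫⁻ t in Ioc (0 : ℝ) 1, ‖G (x + t • v)‖ₑ ^ 2 * ‖v‖ₑ ^ 2 :=
        lintegral_mono' Measure.restrict_le_self le_rfl
    _ = ∫⁻ t in Ioc (0 : ℝ) 1, ∫⁻ x, ‖G (x + t • v)‖ₑ ^ 2 * ‖v‖ₑ ^ 2 :=
        lintegral_lintegral_swap hGm.aemeasurable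
    _ = ∫⁻ t in Ioc (0 : ℝ) 1, ∫⁻ x, ‖G x‖ₑ ^ 2 * ‖v‖ₑ ^ 2 := by
        congr 1
        ext t
        exact lintegral_add_right_eq_self (fun x => ‖G x‖ₑ ^ 2 * ‖v‖ₑ ^ 2) (t • v)
    _ = ‖v‖ₑ ^ 2 * ∫⁻ x, ‖G x‖ₑ ^ 2 := by
        rw [lintegral_mul_const _ (hG.enorm.pow_const 2)]
        simp [mul_comm]

end

section

variable {M : ℕ} {Ω : Set (Euc M)}

/-! ### The modulus of continuity on a Lipschitz domain -/

lemma enorm_sq_eq_ofReal (r : ℝ) : ‖r‖ₑ ^ 2 = ENNReal.ofReal (r ^ 2) := by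
  rw [← ofReal_norm, ← ENNReal.ofReal_pow (norm_nonneg _), Real.norm_eq_abs, sq_abs]

lemma enorm_add_add_sq_le (a b c : ℝ) :
    ‖a + b + c‖ₑ ^ 2 ≤ 3 * (‖a‖ₑ ^ 2 + ‖b‖ₑ ^ 2 + ‖c‖ₑ ^ 2) := by
  simp only [enorm_sq_eq_ofReal]
  rw [← ENNReal.ofReal_add (by positivity) (by positivity),
    ← ENNReal.ofReal_add (by positivity) (by positivity),
    ← ENNReal.ofReal_ofNat 3, ← ENNReal.ofReal_mul (by norm_num)]
  refine ENNReal.ofReal_le_ofReal ?_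
  nlinarith [sq_nonneg (a - b), sq_nonneg (b - c), sq_nonneg (a - c)]

lemma enorm_sub_sq_le (a b : ℝ) : ‖a - b‖ₑ ^ 2 ≤ 2 * (‖a‖ₑ ^ 2 + ‖b‖ₑ ^ 2) := by
  simp only [enorm_sq_eq_ofReal]
  rw [← ENNReal.ofReal_add (by positivity) (by positivity),
    ← ENNReal.ofReal_ofNat 2, ← ENNReal.ofReal_mul (by norm_num)]
  refine ENNReal.ofReal_le_ofReal ?_
  nlinarith [sq_nonneg (a + b)]

/-- The bound for translates by `v`, taken at the points `x + a` instead of `x`. -/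
lemma lintegral_translate_sub_sq_le_of_shift (hΩ : IsOpen Ω) {f : Euc M → ℝ} {G : Euc M → Euc M}
    (hfi : Integrable f) (hG : StronglyMeasurable G)
    (hGi : Integrable G) (hw : IsWeakGradient Ω f G) (v a : Euc M) {E : Set (Euc M)}
    (hE : ∀ x ∈ E, x + a ∈ segDom Ω v) :
    ∫⁻ x in E, ‖f (x + a + v) - f (x + a)‖ₑ ^ 2 ≤ ‖v‖ₑ ^ 2 * ∫⁻ x, ‖G x‖ₑ ^ 2 := by
  calc ∫⁻ x in E, ‖f (x + a + v) - f (x + a)‖ₑ ^ 2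
      ≤ ∫⁻ x in (· + a) ⁻¹' segDom Ω v, ‖f (x + a + v) - f (x + a)‖ₑ ^ 2 :=
        lintegral_mono_set hE
    _ = ∫⁻ y in segDom Ω v, ‖f (y + v) - f y‖ₑ ^ 2 :=
        (measurePreserving_add_right volume a).setLIntegral_comp_preimage_emb
          (MeasurableEquiv.addRight a).measurableEmbedding (fun y => ‖f (y + v) - f y‖ₑ ^ 2) _
    _ ≤ _ := lintegral_translate_sub_sq_le hΩ hfi hG hGi hw v le_rfl

/-- Near every point of the closure of a Lipschitz domain there is a direction `e` such that two
points of the domain can be joined by moving both of them along `e` by a multiple of their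
distance. At interior points `e = 0` will do; at boundary points `e` is the vertical direction of
the graph. -/
lemma IsPolyhedralLipschitzDomain.exists_escape (hΩ : IsPolyhedralLipschitzDomain Ω) {x₀ : Euc M}
    (hx₀ : x₀ ∈ closure Ω) : ∃ (e : Euc M) (L r : ℝ), 0 ≤ L ∧ 0 < r ∧ ‖e‖ ≤ 1 ∧
      ∀ x v : Euc M, x ∈ Ω → x ∈ ball x₀ r → x + v ∈ Ω → x + v ∈ ball x₀ r →
        x ∈ segDom Ω ((L * ‖v‖) • e) ∧ x + (L * ‖v‖) • e ∈ segDom Ω v ∧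
          x + v ∈ segDom Ω ((L * ‖v‖) • e) := by
  have hcv : ∀ (r : ℝ) (x v : Euc M), x ∈ ball x₀ r → x + v ∈ ball x₀ r → ∀ t ∈ Icc (0 : ℝ) 1,
      x + t • v ∈ ball x₀ r := by
    intro r x v hx hxv t ht
    have := (convex_ball x₀ r).add_smul_sub_mem hx hxv ht
    simpa using this
  by_cases hin : x₀ ∈ Ω
  · obtain ⟨r, hr, hb⟩ := Metric.isOpen_iff.1 hΩ.isOpen x₀ hin
    refine ⟨0, 0, r, le_rfl, hr, by simp, fun x v hx hxr hxv hxvr => ⟨?_, ?_, ?_⟩⟩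
    · intro t _; simpa using hx
    · intro t ht; simpa using hb (hcv r x v hxr hxvr t ht)
    · intro t _; simpa using hxv
  have hfr : x₀ ∈ frontier Ω := by rw [hΩ.isOpen.frontier_eq]; exact ⟨hx₀, hin⟩
  obtain ⟨e, R, k, γ, he, hR, hγ, hloc⟩ := hΩ.lipschitz x₀ hfr
  set L : ℝ := k + 1 with hL
  have hL0 : 0 ≤ L := by positivity
  refine ⟨e, L, R / (1 + 2 * L), hL0, by positivity, he.le, ?_⟩
  set r := R / (1 + 2 * L) with hr
  have hr0 : 0 < r := by positivity
  have hrR : r * (1 + 2 * L) = R := by rw [hr]; field_simp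
  have hee : inner ℝ e e = (1 : ℝ) := by rw [real_inner_self_eq_norm_sq, he]; norm_num
  -- the horizontal part of a point, which is not affected by moving along `e`
  set H : Euc M → Euc M := fun y => y - (inner ℝ e y) • e with hH
  have hHe : ∀ (y : Euc M) (c : ℝ), H (y + c • e) = H y := by
    intro y c
    simp only [hH, inner_add_right, inner_smul_right, hee, mul_one, add_smul]
    abel
  have hHv : ∀ (y w : Euc M), γ (H (y + w)) ≤ γ (H y) + k * ‖w‖ := by
    intro y w
    have h1 := hγ.dist_le_mul (H (y + w)) (H y)
    have h2 : H (y + w) - H y = w - (inner ℝ e w) • e := by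
      simp only [hH, inner_add_right, add_smul]
      abel
    have h3 : ‖w - (inner ℝ e w) • e‖ ≤ ‖w‖ := by
      refine le_of_sq_le_sq ?_ (norm_nonneg _)
      rw [norm_sub_sq_real, inner_smul_right, norm_smul, he, real_inner_comm w e, mul_one,
        Real.norm_eq_abs, sq_abs]
      nlinarith [sq_nonneg (inner ℝ w e : ℝ)]
    rw [dist_eq_norm, dist_eq_norm, h2] at h1
    have h4 := le_abs_self (γ (H (y + w)) - γ (H y))
    rw [Real.norm_eq_abs] at h1
    nlinarith [mul_le_mul_of_nonneg_left h3 k.2]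
  have hbR : ∀ (y : Euc M) (c : ℝ), y ∈ ball x₀ r → |c| ≤ L * (2 * r) → y + c • e ∈ ball x₀ R := by
    intro y c hy hc
    rw [mem_ball, dist_eq_norm] at hy ⊢
    have : ‖y + c • e - x₀‖ ≤ ‖y - x₀‖ + |c| := by
      rw [show y + c • e - x₀ = (y - x₀) + c • e by abel]
      refine (norm_add_le _ _).trans ?_
      rw [norm_smul, he, mul_one, Real.norm_eq_abs]
    nlinarith
  have hup : ∀ (y : Euc M) (c : ℝ), y ∈ Ω → y ∈ ball x₀ r → 0 ≤ c → c ≤ L * (2 * r) →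
      y + c • e ∈ Ω := by
    intro y c hy hyr hc hcL
    have hyR : y ∈ ball x₀ R := by simpa using hbR y 0 hyr (by simpa using by positivity)
    rw [hloc _ (hbR y c hyr (by rwa [abs_of_nonneg hc]))]
    have h1 := (hloc y hyR).1 hy
    change γ (H (y + c • e)) < _
    rw [hHe, inner_add_right, inner_smul_right, hee]
    change γ (H y) < _ at h1
    linarith
  intro x v hx hxr hxv hxvr
  have hv2 : ‖v‖ ≤ 2 * r := by
    have h1 : ‖v‖ ≤ ‖x + v - x₀‖ + ‖x - x₀‖ := by
      have := norm_sub_le (x + v - x₀) (x - x₀)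
      rwa [show x + v - x₀ - (x - x₀) = v by abel] at this
    rw [mem_ball, dist_eq_norm] at hxr hxvr
    linarith
  have hs : L * ‖v‖ ≤ L * (2 * r) := mul_le_mul_of_nonneg_left hv2 hL0
  have hs0 : 0 ≤ L * ‖v‖ := by positivity
  refine ⟨?_, ?_, ?_⟩
  · intro t ht
    rw [smul_smul]
    exact hup x _ hx hxr (mul_nonneg ht.1 hs0) ((mul_le_of_le_one_left hs0 ht.2).trans hs)
  · intro t ht
    have hmem := hcv r x v hxr hxvr t ht
    have hxR : x ∈ ball x₀ R := by simpa using hbR x 0 hxr (by simpa using by positivity)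
    rw [show x + (L * ‖v‖) • e + t • v = x + t • v + (L * ‖v‖) • e by abel,
      hloc _ (hbR _ _ hmem (by rwa [abs_of_nonneg hs0]))]
    have h1 := (hloc x hxR).1 hx
    change γ (H x) < _ at h1
    change γ (H (x + t • v + (L * ‖v‖) • e)) < _
    rw [hHe, inner_add_right, inner_add_right, inner_smul_right, inner_smul_right, hee]
    have h2 := hHv x (t • v)
    have h3 : ‖t • v‖ ≤ ‖v‖ := by
      rw [norm_smul, Real.norm_eq_abs, abs_of_nonneg ht.1]
      exact mul_le_of_le_one_left (norm_nonneg _) ht.2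
    have h4 : -‖v‖ ≤ t * inner ℝ e v := by
      have h5 := abs_real_inner_le_norm e (t • v)
      rw [inner_smul_right, he, one_mul] at h5
      linarith [(abs_le.1 (h5.trans h3)).1]
    have h6 := mul_le_mul_of_nonneg_left h3 k.2
    simp only [hL, NNReal.val_eq_coe] at *
    nlinarith
  · intro t ht
    rw [smul_smul]
    exact hup (x + v) _ hxv hxvr (mul_nonneg ht.1 hs0) ((mul_le_of_le_one_left hs0 ht.2).trans hs)

/-- On a Lipschitz domain, the `L²` modulus of continuity of a function is bounded by its `H¹` norm,
for translations that need not keep the segments inside the domain. -/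
theorem IsPolyhedralLipschitzDomain.exists_translate_bound (hΩ : IsPolyhedralLipschitzDomain Ω) :
    ∃ C : ℝ≥0, ∀ (f : Euc M → ℝ) (G : Euc M → Euc M), Measurable f → Integrable f →
      StronglyMeasurable G → Integrable G → IsWeakGradient Ω f G → ∀ v : Euc M,
        ∫⁻ x in {x | x ∈ Ω ∧ x + v ∈ Ω}, ‖f (x + v) - f x‖ₑ ^ 2 ≤
          C * ‖v‖ₑ ^ 2 * ((∫⁻ x, ‖f x‖ₑ ^ 2) + ∫⁻ x, ‖G x‖ₑ ^ 2) := by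
  classical
  have hK : IsCompact (closure Ω) := hΩ.isBounded.isCompact_closure
  choose! e L r hL hr he hesc using fun x₀ (hx₀ : x₀ ∈ closure Ω) => hΩ.exists_escape hx₀
  obtain ⟨J, hJ, hcov⟩ := hK.elim_nhds_subcover (fun x => ball x (r x))
    fun x hx => ball_mem_nhds x (hr x hx)
  have hcov' : closure Ω ⊆ ⋃ j : J, ball (j : Euc M) (r j) := by
    intro x hx
    obtain ⟨j, hj, hxj⟩ := mem_iUnion₂.1 (hcov hx)
    exact mem_iUnion.2 ⟨⟨j, hj⟩, hxj⟩
  obtain ⟨δ, hδ, hleb⟩ := lebesgue_number_lemma_of_metric hK (fun j : J => isOpen_ball) hcov'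
  set C₁ : ℝ≥0 := ∑ j : J, 3 * (2 * (Real.toNNReal (L j)) ^ 2 + 1) with hC₁
  set C₂ : ℝ≥0 := 4 * (Real.toNNReal δ)⁻¹ ^ 2 with hC₂
  refine ⟨C₁ + C₂, fun f G hfm hfi hG hGi hw v => ?_⟩
  set If := ∫⁻ x, ‖f x‖ₑ ^ 2
  set IG := ∫⁻ x, ‖G x‖ₑ ^ 2 with hIG
  rcases lt_or_ge ‖v‖ δ with hv | hv
  · -- short translations: both points lie in one ball of the cover
    set E : J → Set (Euc M) := fun j =>
      {x | (x ∈ Ω ∧ x ∈ ball (j : Euc M) (r j)) ∧ x + v ∈ Ω ∧ x + v ∈ ball (j : Euc M) (r j)} with hE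
    have hsub : {x | x ∈ Ω ∧ x + v ∈ Ω} ⊆ ⋃ j, E j := by
      rintro x ⟨hx, hxv⟩
      obtain ⟨j, hj⟩ := hleb x (subset_closure hx)
      refine mem_iUnion.2 ⟨j, ⟨hx, hj (mem_ball_self hδ)⟩, hxv, hj ?_⟩
      simpa [mem_ball, dist_eq_norm] using hv
    have hloc : ∀ j, ∫⁻ x in E j, ‖f (x + v) - f x‖ₑ ^ 2 ≤
        (3 * (2 * (Real.toNNReal (L j)) ^ 2 + 1) : ℝ≥0) * ‖v‖ₑ ^ 2 * IG := by
      intro j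
      have hjc : (j : Euc M) ∈ closure Ω := hJ j j.2
      set s : Euc M := (L j * ‖v‖) • e j with hs
      have hsn : ‖s‖ₑ ^ 2 ≤ (Real.toNNReal (L j)) ^ 2 * ‖v‖ₑ ^ 2 := by
        rw [← mul_pow]
        refine pow_le_pow_left₀ zero_le ?_ 2
        have h1 : ‖s‖ ≤ L j * ‖v‖ := by
          rw [hs, norm_smul, Real.norm_eq_abs, abs_of_nonneg (mul_nonneg (hL j hjc) (norm_nonneg _))]
          exact mul_le_of_le_one_right (mul_nonneg (hL j hjc) (norm_nonneg _)) (he j hjc)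
        rw [← ofReal_norm, ← ofReal_norm]
        refine (ENNReal.ofReal_le_ofReal h1).trans ?_
        rw [ENNReal.ofReal_mul (hL j hjc)]
        rfl
      have hesc' := fun x (hx : x ∈ E j) => hesc j hjc x v hx.1.1 hx.1.2 hx.2.1 hx.2.2
      have t1 := lintegral_translate_sub_sq_le_of_shift hΩ.isOpen hfi hG hGi hw s 0 (E := E j)
        (fun x hx => by simpa using (hesc' x hx).1)
      have t2 := lintegral_translate_sub_sq_le_of_shift hΩ.isOpen hfi hG hGi hw v s (E := E j)
        (fun x hx => (hesc' x hx).2.1)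
      have t3 := lintegral_translate_sub_sq_le_of_shift hΩ.isOpen hfi hG hGi hw s v (E := E j)
        (fun x hx => (hesc' x hx).2.2)
      simp only [add_zero] at t1
      calc ∫⁻ x in E j, ‖f (x + v) - f x‖ₑ ^ 2
          ≤ ∫⁻ x in E j, 3 * (‖f (x + s) - f x‖ₑ ^ 2 + ‖f (x + s + v) - f (x + s)‖ₑ ^ 2 +
              ‖f (x + v + s) - f (x + v)‖ₑ ^ 2) := by
            refine lintegral_mono fun x => ?_
            have h := enorm_add_add_sq_le (f (x + s) - f x) (f (x + s + v) - f (x + s))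
              (-(f (x + v + s) - f (x + v)))
            rw [enorm_neg] at h
            refine le_trans (le_of_eq ?_) h
            congr 2
            rw [show x + v + s = x + s + v by abel]
            ring
        _ = 3 * ((∫⁻ x in E j, ‖f (x + s) - f x‖ₑ ^ 2) +
              (∫⁻ x in E j, ‖f (x + s + v) - f (x + s)‖ₑ ^ 2) +
              ∫⁻ x in E j, ‖f (x + v + s) - f (x + v)‖ₑ ^ 2) := by
            have m1 : Measurable fun x => ‖f (x + s) - f x‖ₑ ^ 2 := by fun_prop
            have m2 : Measurable fun x => ‖f (x + s + v) - f (x + s)‖ₑ ^ 2 := by fun_prop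
            have m3 : Measurable fun x => ‖f (x + v + s) - f (x + v)‖ₑ ^ 2 := by fun_prop
            rw [lintegral_const_mul' _ _ (by simp), lintegral_add_right _ m3,
              lintegral_add_left m1]
        _ ≤ 3 * ((Real.toNNReal (L j)) ^ 2 * ‖v‖ₑ ^ 2 * IG + ‖v‖ₑ ^ 2 * IG +
              (Real.toNNReal (L j)) ^ 2 * ‖v‖ₑ ^ 2 * IG) := by
            gcongr
            · exact t1.trans (by gcongr)
            · exact t3.trans (by gcongr)
        _ = _ := by push_cast; ring
    calc ∫⁻ x in {x | x ∈ Ω ∧ x + v ∈ Ω}, ‖f (x + v) - f x‖ₑ ^ 2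
        ≤ ∫⁻ x in ⋃ j, E j, ‖f (x + v) - f x‖ₑ ^ 2 := lintegral_mono_set hsub
      _ ≤ ∑' j, ∫⁻ x in E j, ‖f (x + v) - f x‖ₑ ^ 2 := lintegral_iUnion_le _ _
      _ = ∑ j, ∫⁻ x in E j, ‖f (x + v) - f x‖ₑ ^ 2 := tsum_fintype _
      _ ≤ ∑ j : J, (3 * (2 * (Real.toNNReal (L j)) ^ 2 + 1) : ℝ≥0) * ‖v‖ₑ ^ 2 * IG :=
        Finset.sum_le_sum fun j _ => hloc j
      _ = C₁ * ‖v‖ₑ ^ 2 * IG := by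
        rw [← Finset.sum_mul, ← Finset.sum_mul, hC₁, ENNReal.ofNNReal_finsetSum]
      _ ≤ _ := by
        push_cast
        gcongr
        · exact le_self_add
        · exact le_add_self
  · -- long translations
    have hone : (1 : ℝ≥0∞) ≤ ((Real.toNNReal δ)⁻¹ ^ 2 : ℝ≥0) * ‖v‖ₑ ^ 2 := by
      push_cast
      rw [← mul_pow]
      refine one_le_pow₀ ?_
      rw [enorm_eq_nnnorm, ← ENNReal.coe_mul, ENNReal.one_le_coe_iff]
      have h0 : 0 < Real.toNNReal δ := Real.toNNReal_pos.2 hδ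
      rw [inv_mul_eq_div, one_le_div h0]
      exact Real.toNNReal_le_iff_le_coe.2 hv
    calc ∫⁻ x in {x | x ∈ Ω ∧ x + v ∈ Ω}, ‖f (x + v) - f x‖ₑ ^ 2
        ≤ ∫⁻ x, ‖f (x + v) - f x‖ₑ ^ 2 := lintegral_mono' Measure.restrict_le_self le_rfl
      _ ≤ ∫⁻ x, 2 * (‖f (x + v)‖ₑ ^ 2 + ‖f x‖ₑ ^ 2) := lintegral_mono fun x => enorm_sub_sq_le _ _
      _ = 2 * (If + If) := by
        have m1 : Measurable fun x => ‖f (x + v)‖ₑ ^ 2 := by fun_prop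
        have m2 : Measurable fun x => ‖f x‖ₑ ^ 2 := by fun_prop
        rw [lintegral_const_mul' _ _ (by simp), lintegral_add_left m1,
          lintegral_add_right_eq_self (fun x => ‖f x‖ₑ ^ 2) v]
      _ = 1 * (4 * If) := by ring
      _ ≤ (((Real.toNNReal δ)⁻¹ ^ 2 : ℝ≥0) * ‖v‖ₑ ^ 2) * (4 * (If + IG)) := by
        gcongr
        exact le_self_add
      _ = C₂ * ‖v‖ₑ ^ 2 * (If + IG) := by rw [hC₂]; push_cast; ring
      _ ≤ _ := by
        push_cast
        gcongr
        exact le_add_self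

end

section

variable {M : ℕ} {Ω : Set (Euc M)}

/-! ### Elements of a triangulation and their volumes -/

/-- The closed simplex spanned by a finite set of vertices. -/
abbrev hull (s : Finset (Euc M)) : Set (Euc M) := convexHull ℝ (s : Set (Euc M))

lemma measure_hyperplane_eq_zero {p : Euc M} (hp : p ≠ 0) (c : ℝ) :
    volume {y : Euc M | inner ℝ p y = c} = 0 := by
  let S : AffineSubspace ℝ (Euc M) :=
    { carrier := {y | inner ℝ p y = c}
      smul_vsub_vadd_mem' := by
        intro t a b d ha hb hd
        simp only [mem_ofPred_eq] at ha hb hd ⊢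
        simp [inner_add_right, inner_smul_right, inner_sub_right, ha, hb, hd] }
  refine Measure.addHaar_affineSubspace volume S fun h => hp ?_
  have h0 : (0 : Euc M) ∈ S := h ▸ AffineSubspace.mem_top ℝ _ _
  have h1 : p ∈ S := h ▸ AffineSubspace.mem_top ℝ _ _
  have h0' : inner ℝ p (0 : Euc M) = c := h0
  have h1' : inner ℝ p p = c := h1
  rw [inner_zero_right] at h0'
  rw [← h0'] at h1'
  exact inner_self_eq_zero.1 h1'

lemma IsPolyhedralLipschitzDomain.measure_frontier (hΩ : IsPolyhedralLipschitzDomain Ω) :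
    volume (frontier Ω) = 0 := by
  obtain ⟨P, hP, hsub⟩ := hΩ.polyhedral
  refine measure_mono_null hsub ((measure_biUnion_null_iff P.countable_toSet).2 fun p hp => ?_)
  exact measure_hyperplane_eq_zero (hP p hp) p.2

lemma IsPolyhedralLipschitzDomain.restrict_closure (hΩ : IsPolyhedralLipschitzDomain Ω) :
    volume.restrict (closure Ω) = volume.restrict Ω := by
  refine (Measure.restrict_congr_set ?_).symm
  have h : (Ω ∪ frontier Ω : Set (Euc M)) = closure Ω := by
    rw [hΩ.isOpen.frontier_eq, union_sdiff_cancel subset_closure]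
  rw [← h]
  exact (union_ae_eq_left_of_ae_eq_empty (ae_eq_empty.2 hΩ.measure_frontier)).symm

lemma volume_hull_eq_zero {s : Finset (Euc M)} (hs : s.card ≤ M) : volume (hull s) = 0 := by
  classical
  rcases s.eq_empty_or_nonempty with rfl | hne
  · simp [hull]
  refine measure_mono_null (convexHull_subset_affineSpan _)
    (Measure.addHaar_affineSubspace volume _ fun h => ?_)
  have hpos := hne.card_pos
  have h1 := finrank_vectorSpan_image_finset_le ℝ (id : Euc M → Euc M) s (n := s.card - 1) (by omega)
  rw [Finset.image_id, ← direction_affineSpan, h, AffineSubspace.direction_top, finrank_top,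
    finrank_euclideanSpace_fin] at h1
  omega

namespace Triangulation

/-- The elements of a triangulation, as a finite set. -/
noncomputable def cellFinset (T : Triangulation Ω) : Finset (Finset (Euc M)) :=
  (T.finite_faces.subset (fun _ hs => hs.1 : T.cells ⊆ T.faces)).toFinset

@[simp] lemma mem_cellFinset {T : Triangulation Ω} {s : Finset (Euc M)} :
    s ∈ T.cellFinset ↔ s ∈ T.cells := by simp [cellFinset]

lemma closure_eq_iUnion (T : Triangulation Ω) : closure Ω = ⋃ s ∈ T.cellFinset, hull s := by
  ext x
  rw [← T.space_eq, Geometry.SimplicialComplex.mem_space_iff, mem_iUnion₂]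
  constructor
  · rintro ⟨s, hs, hx⟩
    obtain ⟨t, ht, hst, hc⟩ := T.pure s hs
    exact ⟨t, mem_cellFinset.2 ⟨ht, hc⟩, convexHull_mono (Finset.coe_subset.2 hst) hx⟩
  · rintro ⟨s, hs, hx⟩
    exact ⟨s, (mem_cellFinset.1 hs).1, hx⟩

lemma hull_subset (T : Triangulation Ω) {s : Finset (Euc M)} (hs : s ∈ T.cells) :
    hull s ⊆ closure Ω := by
  rw [T.closure_eq_iUnion]
  exact subset_biUnion_of_mem (u := fun s => hull s) (mem_cellFinset.2 hs)

lemma mem_nodes_of_mem (T : Triangulation Ω) {s : Finset (Euc M)} (hs : s ∈ T.cells) {a : Euc M}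
    (ha : a ∈ s) : a ∈ T.nodes :=
  T.down_closed hs.1 (Finset.singleton_subset_iff.2 ha) (Finset.singleton_nonempty a)

lemma exists_cell_of_mem_nodes (T : Triangulation Ω) {a : Euc M} (ha : a ∈ T.nodes) :
    ∃ s ∈ T.cells, a ∈ s := by
  obtain ⟨t, ht, hst, hc⟩ := T.pure _ ha
  exact ⟨t, ⟨ht, hc⟩, hst (by simp)⟩

lemma nodes_subset (T : Triangulation Ω) : T.nodes ⊆ closure Ω := by
  intro a ha
  obtain ⟨s, hs, has⟩ := T.exists_cell_of_mem_nodes ha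
  exact T.hull_subset hs (subset_convexHull ℝ _ has)

lemma finite_nodes (T : Triangulation Ω) : T.nodes.Finite := by
  refine (T.cellFinset.finite_toSet.biUnion fun s _ => s.finite_toSet).subset fun a ha => ?_
  obtain ⟨s, hs, has⟩ := T.exists_cell_of_mem_nodes ha
  exact mem_iUnion₂.2 ⟨s, mem_cellFinset.2 hs, has⟩

lemma isClosed_hull (s : Finset (Euc M)) : IsClosed (hull s) := s.finite_toSet.isClosed_convexHull ℝ

lemma measurableSet_hull (s : Finset (Euc M)) : MeasurableSet (hull s) :=
  (isClosed_hull s).measurableSet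

lemma isCompact_hull (s : Finset (Euc M)) : IsCompact (hull s) :=
  s.finite_toSet.isCompact_convexHull ℝ

/-- Two different elements meet in a face of lower dimension. -/
lemma aedisjoint_hull (T : Triangulation Ω) {s t : Finset (Euc M)} (hs : s ∈ T.cells)
    (ht : t ∈ T.cells) (hst : s ≠ t) : AEDisjoint volume (hull s) (hull t) := by
  classical
  have h := T.inter_subset_convexHull hs.1 ht.1
  rw [← Finset.coe_inter] at h
  refine measure_mono_null h (volume_hull_eq_zero ?_)
  have h1 : s ∩ t ⊂ s := by
    refine Finset.ssubset_iff_subset_ne.2 ⟨Finset.inter_subset_left, fun h => hst ?_⟩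
    exact Finset.eq_of_subset_of_card_le (Finset.inter_eq_left.1 h) (by rw [hs.2, ht.2])
  have := Finset.card_lt_card h1
  rw [hs.2] at this
  omega

lemma lintegral_eq_sum (T : Triangulation Ω) (hΩ : IsPolyhedralLipschitzDomain Ω)
    (g : Euc M → ℝ≥0∞) :
    ∫⁻ x in Ω, g x = ∑ s ∈ T.cellFinset, ∫⁻ x in hull s, g x := by
  rw [← hΩ.restrict_closure, T.closure_eq_iUnion]
  refine lintegral_biUnion_finset₀ (fun s hs t ht hst => ?_)
    (fun s _ => (measurableSet_hull s).nullMeasurableSet) g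
  exact T.aedisjoint_hull (mem_cellFinset.1 hs) (mem_cellFinset.1 ht) hst

lemma restrict_eq_sum (T : Triangulation Ω) (hΩ : IsPolyhedralLipschitzDomain Ω) :
    volume.restrict Ω = ∑ s ∈ T.cellFinset, volume.restrict (hull s) := by
  ext A hA
  have h := T.lintegral_eq_sum hΩ (A.indicator 1)
  simpa [lintegral_indicator_one hA, Measure.finsetSum_apply] using h

lemma integrableOn_hull (T : Triangulation Ω) (hΩ : IsPolyhedralLipschitzDomain Ω)
    {g : Euc M → ℝ} (hg : IntegrableOn g Ω) {s : Finset (Euc M)} (hs : s ∈ T.cells) :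
    IntegrableOn g (hull s) := by
  rw [IntegrableOn, ← hΩ.restrict_closure] at hg
  exact IntegrableOn.mono_set hg (T.hull_subset hs)

lemma integral_eq_sum (T : Triangulation Ω) (hΩ : IsPolyhedralLipschitzDomain Ω)
    {g : Euc M → ℝ} (hg : IntegrableOn g Ω) :
    ∫ x in Ω, g x = ∑ s ∈ T.cellFinset, ∫ x in hull s, g x := by
  rw [T.restrict_eq_sum hΩ]
  exact integral_finsetSum_measure fun s hs => T.integrableOn_hull hΩ hg (mem_cellFinset.1 hs)

/-- Every element contains a ball with radius at least the mesh size over `κ`. -/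
structure IsRegular (T : Triangulation Ω) (κ : ℝ) : Prop where
  pos : 0 < κ
  exists_ball : ∀ s ∈ T.cells, ∃ (x : Euc M) (r : ℝ), closedBall x r ⊆ hull s ∧ T.meshSize ≤ κ * r

lemma exists_cell (T : Triangulation Ω) (hΩ : IsPolyhedralLipschitzDomain Ω) :
    ∃ s, s ∈ T.cells := by
  obtain ⟨x, hx⟩ := hΩ.isConnected.nonempty
  have := subset_closure hx
  rw [T.closure_eq_iUnion] at this
  obtain ⟨s, hs, -⟩ := mem_iUnion₂.1 this
  exact ⟨s, mem_cellFinset.1 hs⟩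

lemma diam_le_meshSize (T : Triangulation Ω) {s : Finset (Euc M)} (hs : s ∈ T.cells) :
    diam (hull s) ≤ T.meshSize := by
  refine le_csSup ?_ (mem_image_of_mem _ hs)
  exact ((T.finite_faces.subset (fun _ hs => hs.1 : T.cells ⊆ T.faces)).image _).bddAbove

lemma dist_le_meshSize (T : Triangulation Ω) {s : Finset (Euc M)} (hs : s ∈ T.cells) {x y : Euc M}
    (hx : x ∈ hull s) (hy : y ∈ hull s) : dist x y ≤ T.meshSize :=
  (dist_le_diam_of_mem (isCompact_hull s).isBounded hx hy).trans (T.diam_le_meshSize hs)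

lemma meshSize_pos (T : Triangulation Ω) (hΩ : IsPolyhedralLipschitzDomain Ω) (hM : 0 < M) :
    0 < T.meshSize := by
  obtain ⟨s, hs⟩ := T.exists_cell hΩ
  have h1 : 1 < s.card := by rw [hs.2]; omega
  obtain ⟨a, ha, b, hb, hab⟩ := Finset.one_lt_card.1 h1
  exact (dist_pos.2 hab).trans_le (T.dist_le_meshSize hs (subset_convexHull ℝ _ ha)
    (subset_convexHull ℝ _ hb))

end Triangulation

/-- The volume of the unit ball. -/
noncomputable def unitVol (M : ℕ) : ℝ := volume.real (ball (0 : Euc M) 1)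

lemma unitVol_pos : 0 < unitVol M :=
  ENNReal.toReal_pos (measure_ball_pos _ _ one_pos).ne' measure_ball_lt_top.ne

namespace Triangulation

lemma volume_hull_ne_top (s : Finset (Euc M)) : volume (hull s) ≠ ⊤ :=
  (isCompact_hull s).measure_lt_top.ne

lemma IsRegular.le_volume {T : Triangulation Ω} {κ : ℝ} (hT : T.IsRegular κ)
    {s : Finset (Euc M)} (hs : s ∈ T.cells) (h0 : 0 < T.meshSize) :
    unitVol M * (T.meshSize / κ) ^ M ≤ volume.real (hull s) := by
  obtain ⟨x, r, hsub, hr⟩ := hT.exists_ball s hs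
  have h1 : T.meshSize / κ ≤ r := by rwa [div_le_iff₀' hT.pos]
  have h2 : 0 ≤ T.meshSize / κ := div_nonneg h0.le hT.pos.le
  have h3 := measureReal_mono hsub (volume_hull_ne_top s)
  rw [Measure.addHaar_real_closedBall volume x (h2.trans h1), finrank_euclideanSpace_fin] at h3
  refine le_trans ?_ h3
  rw [mul_comm]
  exact mul_le_mul_of_nonneg_right (pow_le_pow_left₀ h2 h1 M) unitVol_pos.le

lemma IsRegular.volume_pos {T : Triangulation Ω} {κ : ℝ} (hT : T.IsRegular κ)
    {s : Finset (Euc M)} (hs : s ∈ T.cells) (h0 : 0 < T.meshSize) : 0 < volume.real (hull s) :=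
  lt_of_lt_of_le (mul_pos unitVol_pos (pow_pos (div_pos h0 hT.pos) M)) (hT.le_volume hs h0)

end Triangulation

/-- A shape-regular and quasi-uniform family has a common regularity constant. -/
lemma exists_isRegular {ι : Type*} {𝒯 : ι → Triangulation Ω} (hreg : ShapeRegular 𝒯)
    (hqu : QuasiUniform 𝒯) : ∃ κ : ℝ, ∀ i, (𝒯 i).IsRegular κ := by
  obtain ⟨σ, hσ, hσ'⟩ := hreg
  obtain ⟨τ, hτ, hτ'⟩ := hqu
  refine ⟨τ * σ, fun i => ⟨by positivity, fun s hs => ?_⟩⟩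
  obtain ⟨x, r, hsub, hd⟩ := hσ' i s hs
  refine ⟨x, r, hsub, (hτ' i s hs).trans ?_⟩
  rw [mul_assoc]
  exact mul_le_mul_of_nonneg_left hd hτ.le

end

section

variable {M : ℕ} {Ω : Set (Euc M)} {F : Type*} [NormedAddCommGroup F]

/-! ### Finite element functions on an element -/

lemma zeroExt_coe (v : C(closure Ω, F)) (x : closure Ω) : zeroExt v (x : Euc M) = v x :=
  Subtype.val_injective.extend_apply v 0 x

lemma zeroExt_of_mem (v : C(closure Ω, F)) {x : Euc M} (hx : x ∈ closure Ω) :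
    zeroExt v x = v ⟨x, hx⟩ := zeroExt_coe v ⟨x, hx⟩

lemma continuousOn_zeroExt (v : C(closure Ω, F)) : ContinuousOn (zeroExt v) (closure Ω) := by
  rw [continuousOn_iff_continuous_domRestrict]
  convert v.continuous using 1
  ext x
  exact zeroExt_coe v x

lemma IsPolyhedralLipschitzDomain.isFiniteMeasure_restrict (hΩ : IsPolyhedralLipschitzDomain Ω) :
    IsFiniteMeasure (volume.restrict Ω) :=
  MeasureTheory.isFiniteMeasure_restrict.2 hΩ.isBounded.measure_lt_top.ne

lemma memLp_zeroExt (hΩ : IsPolyhedralLipschitzDomain Ω) (v : C(closure Ω, F)) (p : ℝ≥0∞) :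
    MemLp (zeroExt v) p (volume.restrict Ω) := by
  have := hΩ.isFiniteMeasure_restrict
  obtain ⟨C, hC⟩ := hΩ.isBounded.isCompact_closure.exists_bound_of_continuousOn
    (continuousOn_zeroExt v)
  refine MemLp.of_bound (C := C) ?_ ?_
  · exact ((continuousOn_zeroExt v).mono subset_closure).aestronglyMeasurable
      hΩ.isOpen.measurableSet
  · exact (ae_restrict_iff' hΩ.isOpen.measurableSet).2
      (ae_of_all _ fun x hx => hC x (subset_closure hx))

variable {T : Triangulation Ω}

/-- The sum over the elements of the volume times the squared jumps of the nodal values between the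
vertices. Up to the factor `h²` it is equivalent to the Dirichlet energy. -/
noncomputable def jumpEnergy (T : Triangulation Ω) (g : Euc M → F) : ℝ :=
  ∑ s ∈ T.cellFinset, volume.real (hull s) * ∑ a ∈ s, ∑ b ∈ s, ‖g a - g b‖ ^ 2

variable [NormedSpace ℝ F]

lemma exists_affine_on_hull {v : C(closure Ω, F)} (hv : v ∈ P1 T F) {s : Finset (Euc M)}
    (hs : s ∈ T.cells) : ∃ A : Euc M →ᵃ[ℝ] F, ∀ x ∈ hull s, zeroExt v x = A x := by
  obtain ⟨A, hA⟩ := hv s hs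
  refine ⟨A, fun x hx => ?_⟩
  rw [zeroExt_of_mem v (T.hull_subset hs hx)]
  exact hA _ hx

lemma map_sum_smul_of_sum_eq_one (A : Euc M →ᵃ[ℝ] F) {s : Finset (Euc M)} {l : Euc M → ℝ}
    (hl : ∑ a ∈ s, l a = 1) : A (∑ a ∈ s, l a • a) = ∑ a ∈ s, l a • A a := by
  have h : ∀ x, A x = A.linear x + A 0 := fun x => congrFun A.decomp x
  have h' : ∀ a, l a • A a = A.linear (l a • a) + l a • A 0 := fun a => by
    rw [h a, smul_add, map_smul]
  rw [h, map_sum, Finset.sum_congr rfl fun a _ => h' a, Finset.sum_add_distrib, ← Finset.sum_smul,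
    hl, one_smul]

/-- Barycentric weights of a point of an element, through which every finite element function is
recovered from its nodal values. -/
lemma exists_weights {s : Finset (Euc M)} (hs : s ∈ T.cells) {x : Euc M} (hx : x ∈ hull s) :
    ∃ l : Euc M → ℝ, (∀ a ∈ s, 0 ≤ l a) ∧ ∑ a ∈ s, l a = 1 ∧
      ∀ v ∈ P1 T ℝ, zeroExt v x = ∑ a ∈ s, l a * zeroExt v a := by
  obtain ⟨l, h0, h1, h2⟩ := Finset.mem_convexHull'.1 hx
  refine ⟨l, h0, h1, fun v hv => ?_⟩
  obtain ⟨A, hA⟩ := exists_affine_on_hull hv hs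
  rw [hA x hx, ← h2, map_sum_smul_of_sum_eq_one A h1]
  refine Finset.sum_congr rfl fun a ha => ?_
  rw [hA a (subset_convexHull ℝ _ ha), smul_eq_mul]

lemma norm_zeroExt_le_of_hull {v : C(closure Ω, F)} (hv : v ∈ P1 T F) {s : Finset (Euc M)}
    (hs : s ∈ T.cells) {W : ℝ} (hW : ∀ a ∈ s, ‖zeroExt v a‖ ≤ W) {x : Euc M} (hx : x ∈ hull s) :
    ‖zeroExt v x‖ ≤ W := by
  obtain ⟨A, hA⟩ := exists_affine_on_hull hv hs
  rw [hA x hx]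
  have hconv : Convex ℝ (A ⁻¹' closedBall 0 W) := (convex_closedBall _ _).affine_preimage A
  have := convexHull_min (fun a ha => ?_) hconv hx
  · simpa using this
  · simpa [hA a (subset_convexHull ℝ _ ha)] using hW a ha

/-- The mass matrix of an element is bounded from below by its volume: near the vertex where the
function is largest, on the copy of the element shrunk by the factor `1/4`, the function stays
above half of its maximum. -/
lemma volume_mul_sum_sq_le (hΩ : IsPolyhedralLipschitzDomain Ω) {w : C(closure Ω, ℝ)}
    (hw : w ∈ P1 T ℝ) {s : Finset (Euc M)} (hs : s ∈ T.cells) :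
    volume.real (hull s) * ∑ a ∈ s, zeroExt w a ^ 2 ≤
      ((M + 1) * 4 ^ (M + 1)) * ∫ x in hull s, zeroExt w x ^ 2 := by
  have hne : s.Nonempty := by
    rw [← Finset.card_pos, hs.2]; omega
  obtain ⟨a, ha, hmax⟩ := s.exists_max_image (fun a => |zeroExt w a|) hne
  obtain ⟨A, hA⟩ := exists_affine_on_hull hw hs
  set m := |zeroExt w a| with hm
  have hahull : a ∈ hull s := subset_convexHull ℝ _ ha
  set K' := AffineMap.homothety a (1 / 4 : ℝ) '' hull s with hK'
  have hform : ∀ y, AffineMap.homothety a (1 / 4 : ℝ) y = AffineMap.lineMap a y (1 / 4 : ℝ) :=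
    fun y => rfl
  have hK'sub : K' ⊆ hull s := by
    rintro _ ⟨y, hy, rfl⟩
    rw [hform]
    exact (convex_convexHull ℝ _).lineMap_mem hahull hy ⟨by norm_num, by norm_num⟩
  have hlow : ∀ x ∈ K', m ^ 2 / 4 ≤ zeroExt w x ^ 2 := by
    intro x hx
    have hxs := hK'sub hx
    obtain ⟨y, hy, rfl⟩ := hx
    have h1 : |zeroExt w y| ≤ m := norm_zeroExt_le_of_hull hw hs hmax hy
    have h2 : zeroExt w (AffineMap.homothety a (1 / 4 : ℝ) y) =
        (3 / 4) * zeroExt w a + (1 / 4) * zeroExt w y := by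
      rw [hA _ hxs, hA _ hahull, hA _ hy, hform, AffineMap.apply_lineMap,
        AffineMap.lineMap_apply_ring]
      ring
    rw [h2, ← sq_abs (3 / 4 * _ + _)]
    have h3 : m / 2 ≤ |3 / 4 * zeroExt w a + 1 / 4 * zeroExt w y| := by
      have h4 := abs_sub_abs_le_abs_sub (3 / 4 * zeroExt w a) (-(1 / 4 * zeroExt w y))
      rw [sub_neg_eq_add, abs_neg, abs_mul, abs_mul, abs_of_pos (by norm_num : (0 : ℝ) < 3 / 4),
        abs_of_pos (by norm_num : (0 : ℝ) < 1 / 4)] at h4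
      linarith
    have : 0 ≤ m := abs_nonneg _
    nlinarith
  have hvol : volume.real K' = (1 / 4 : ℝ) ^ M * volume.real (hull s) := by
    rw [Measure.real, Measure.addHaar_image_homothety, finrank_euclideanSpace_fin,
      ENNReal.toReal_mul, ENNReal.toReal_ofReal (abs_nonneg _), abs_of_nonneg (by positivity)]
    rfl
  have hint : IntegrableOn (fun x => zeroExt w x ^ 2) (hull s) :=
    T.integrableOn_hull hΩ (memLp_zeroExt hΩ w 2).integrable_sq hs
  have hmono : ∫ x in K', zeroExt w x ^ 2 ≤ ∫ x in hull s, zeroExt w x ^ 2 :=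
    setIntegral_mono_set hint (ae_of_all _ fun x => sq_nonneg _) hK'sub.eventuallyLE
  have hK'm : MeasurableSet K' :=
    ((Triangulation.isCompact_hull s).image
      (AffineMap.homothety a (1 / 4 : ℝ)).continuous_of_finiteDimensional).measurableSet
  have hconst : m ^ 2 / 4 * volume.real K' ≤ ∫ x in K', zeroExt w x ^ 2 := by
    have h := setIntegral_mono_on (μ := volume) (f := fun _ => m ^ 2 / 4)
      (integrableOn_const (measure_ne_top_of_subset hK'sub (Triangulation.volume_hull_ne_top s)))
      (hint.mono_set hK'sub) hK'm hlow
    rw [setIntegral_const, smul_eq_mul, mul_comm] at h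
    exact h
  have hsum : ∑ b ∈ s, zeroExt w b ^ 2 ≤ (M + 1) * m ^ 2 := by
    calc ∑ b ∈ s, zeroExt w b ^ 2 ≤ ∑ _b ∈ s, m ^ 2 :=
          Finset.sum_le_sum fun b hb => by
            rw [← sq_abs]
            exact pow_le_pow_left₀ (abs_nonneg _) (hmax b hb) 2
      _ = (M + 1) * m ^ 2 := by rw [Finset.sum_const, hs.2]; simp
  rw [hvol] at hconst
  have h4 : (4 : ℝ) ^ (M + 1) * (m ^ 2 / 4 * ((1 / 4) ^ M * volume.real (hull s))) =
      m ^ 2 * volume.real (hull s) := by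
    rw [pow_succ, one_div, inv_pow]
    field_simp
  calc volume.real (hull s) * ∑ b ∈ s, zeroExt w b ^ 2
      ≤ volume.real (hull s) * ((M + 1) * m ^ 2) := mul_le_mul_of_nonneg_left hsum measureReal_nonneg
    _ = (M + 1) * (4 ^ (M + 1) * (m ^ 2 / 4 * ((1 / 4) ^ M * volume.real (hull s)))) := by
        rw [h4]; ring
    _ ≤ (M + 1) * (4 ^ (M + 1) * ∫ x in hull s, zeroExt w x ^ 2) := by
        gcongr
        exact hconst.trans hmono
    _ = _ := by ring

lemma exists_mem_P1_eq_on_nodes (T : Triangulation Ω)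
    (g : Euc M → ℝ) : ∃ w ∈ P1 T ℝ, ∀ a ∈ T.nodes, zeroExt w a = g a := by
  let N : Set (closure Ω) := {x | (x : Euc M) ∈ T.nodes}
  have hN : N.Finite := T.finite_nodes.preimage Subtype.val_injective.injOn
  have : Finite N := hN.to_subtype
  obtain ⟨G, hG⟩ := ContinuousMap.exists_restrict_eq hN.isClosed
    (⟨fun x : N => g x, continuous_of_discreteTopology⟩ : C(N, ℝ))
  refine ⟨nodalInterp T G, nodalInterp_mem T G, fun a ha => ?_⟩
  have hac := T.nodes_subset ha
  rw [zeroExt_of_mem _ hac, nodalInterp_apply T G ⟨a, hac⟩ ha]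
  exact congrArg (fun k : C(N, ℝ) => k ⟨⟨a, hac⟩, ha⟩) hG

lemma zeroExt_nodalInterp (g : C(closure Ω, F)) {a : Euc M} (ha : a ∈ T.nodes) :
    zeroExt (nodalInterp T g) a = zeroExt g a := by
  rw [zeroExt_of_mem _ (T.nodes_subset ha), zeroExt_of_mem _ (T.nodes_subset ha),
    nodalInterp_apply T g _ ha]

/-! ### The gradient of a finite element function -/

lemma exists_cell_gradient {v : C(closure Ω, F)} (hv : v ∈ P1 T F) :
    ∃ A : Finset (Euc M) → Euc M →ᵃ[ℝ] F, ∀ s ∈ T.cells, ∀ x ∈ hull s, zeroExt v x = A s x := by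
  classical
  have h : ∀ s : Finset (Euc M), ∃ A : Euc M →ᵃ[ℝ] F, s ∈ T.cells → ∀ x ∈ hull s,
      zeroExt v x = A x := by
    intro s
    by_cases hs : s ∈ T.cells
    · obtain ⟨A, hA⟩ := exists_affine_on_hull hv hs
      exact ⟨A, fun _ => hA⟩
    · exact ⟨0, fun h => absurd h hs⟩
  choose A hA using h
  exact ⟨A, hA⟩

lemma gradNorm_sq_eq (hΩ : IsPolyhedralLipschitzDomain Ω) {v : C(closure Ω, F)}
    {A : Finset (Euc M) → Euc M →ᵃ[ℝ] F}
    (hA : ∀ s ∈ T.cells, ∀ x ∈ hull s, zeroExt v x = A s x) :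
    gradNorm v ^ 2 = ∑ s ∈ T.cellFinset, volume.real (hull s) *
      ∑ j : Fin M, ‖(A s).linear (EuclideanSpace.single j (1 : ℝ))‖ ^ 2 := by
  set D : Euc M → ℝ := fun x =>
    Real.sqrt (∑ j : Fin M, ‖fderiv ℝ (zeroExt v) x (EuclideanSpace.single j (1 : ℝ))‖ ^ 2) with hD
  have hfd : ∀ s ∈ T.cells, ∀ x ∈ interior (hull s), ‖D x‖ₑ ^ 2 = ENNReal.ofReal
      (∑ j : Fin M, ‖(A s).linear (EuclideanSpace.single j (1 : ℝ))‖ ^ 2) := by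
    intro s hs x hx
    have h1 : HasFDerivAt (fun y => A s y) (A s).linear.toContinuousLinearMap x := by
      have h2 : (fun y => A s y) = fun y => (A s).linear.toContinuousLinearMap y + A s 0 := by
        ext y
        exact congrFun (A s).decomp y
      rw [h2]
      exact (A s).linear.toContinuousLinearMap.hasFDerivAt.add_const _
    have h3 : HasFDerivAt (zeroExt v) (A s).linear.toContinuousLinearMap x := by
      refine h1.congr_of_eventuallyEq ?_
      filter_upwards [mem_interior_iff_mem_nhds.1 hx] with y hy
      exact hA s hs y hy
    rw [enorm_sq_eq_ofReal, hD]
    simp only [h3.fderiv]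
    rw [Real.sq_sqrt (by positivity)]
    rfl
  have h1 : (eLpNorm D 2 (volume.restrict Ω)) ^ 2 = ∑ s ∈ T.cellFinset, ENNReal.ofReal
      (∑ j : Fin M, ‖(A s).linear (EuclideanSpace.single j (1 : ℝ))‖ ^ 2) * volume (hull s) := by
    have h2 := eLpNorm_nnreal_pow_eq_lintegral (f := D) (μ := volume.restrict Ω)
      (p := 2) (by norm_num)
    simp only [NNReal.coe_ofNat, ENNReal.rpow_ofNat, ENNReal.coe_ofNat] at h2
    rw [h2, T.lintegral_eq_sum hΩ]
    refine Finset.sum_congr rfl fun s hs => ?_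
    rw [← setLIntegral_const]
    refine setLIntegral_congr_fun_ae (Triangulation.measurableSet_hull s) ?_
    have hfr : volume (frontier (hull s)) = 0 :=
      (convex_convexHull ℝ _).addHaar_frontier volume
    have hn : ∀ᵐ x, x ∉ frontier (hull s) := measure_eq_zero_iff_ae_notMem.1 hfr
    filter_upwards [hn] with x hx hxs
    refine hfd s (T.mem_cellFinset.1 hs) x ?_
    by_contra hni
    exact hx ⟨subset_closure hxs, hni⟩
  have h2 : gradNorm v ^ 2 = ((eLpNorm D 2 (volume.restrict Ω)) ^ 2).toReal := by
    rw [ENNReal.toReal_pow]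
    rfl
  rw [h2, h1, ENNReal.toReal_sum fun s _ => ENNReal.mul_ne_top ENNReal.ofReal_ne_top
    (Triangulation.volume_hull_ne_top s)]
  refine Finset.sum_congr rfl fun s _ => ?_
  rw [ENNReal.toReal_mul, ENNReal.toReal_ofReal (by positivity), mul_comm]
  rfl

lemma gradNorm_nonneg (v : C(closure Ω, F)) : 0 ≤ gradNorm v := ENNReal.toReal_nonneg

lemma norm_linear_sq_le (A : Euc M →ᵃ[ℝ] F) (a b : Euc M) :
    ‖A a - A b‖ ^ 2 ≤ ‖a - b‖ ^ 2 *
      ∑ j : Fin M, ‖A.linear (EuclideanSpace.single j (1 : ℝ))‖ ^ 2 := by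
  have h1 : A a - A b = A.linear (a - b) := by
    rw [← vsub_eq_sub, ← vsub_eq_sub, A.linearMap_vsub]
  have h2 : A.linear (a - b) = ∑ j : Fin M, (a - b) j • A.linear (EuclideanSpace.single j (1 : ℝ)) := by
    conv_lhs => rw [← (EuclideanSpace.basisFun (Fin M) ℝ).sum_repr (a - b)]
    simp
  rw [h1, h2, EuclideanSpace.norm_sq_eq]
  refine le_trans ?_ (Finset.sum_mul_sq_le_sq_mul_sq Finset.univ _ _)
  refine pow_le_pow_left₀ (norm_nonneg _) ((norm_sum_le _ _).trans (le_of_eq ?_)) 2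
  simp [norm_smul]

/-- The jumps of the nodal values are bounded by the gradient. -/
lemma jumpEnergy_le (hΩ : IsPolyhedralLipschitzDomain Ω) {v : C(closure Ω, F)}
    (hv : v ∈ P1 T F) :
    jumpEnergy T (zeroExt v) ≤ ((M + 1) * T.meshSize) ^ 2 * gradNorm v ^ 2 := by
  obtain ⟨A, hA⟩ := exists_cell_gradient hv
  rw [gradNorm_sq_eq hΩ hA, jumpEnergy, Finset.mul_sum]
  refine Finset.sum_le_sum fun s hs => ?_
  have hs' := T.mem_cellFinset.1 hs
  rw [mul_left_comm]
  refine mul_le_mul_of_nonneg_left ?_ measureReal_nonneg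
  set g := ∑ j : Fin M, ‖(A s).linear (EuclideanSpace.single j (1 : ℝ))‖ ^ 2
  have hg : 0 ≤ g := by positivity
  calc ∑ a ∈ s, ∑ b ∈ s, ‖zeroExt v a - zeroExt v b‖ ^ 2
      ≤ ∑ _a ∈ s, ∑ _b ∈ s, T.meshSize ^ 2 * g := by
        refine Finset.sum_le_sum fun a ha => Finset.sum_le_sum fun b hb => ?_
        have ha' := subset_convexHull ℝ (s : Set (Euc M)) ha
        have hb' := subset_convexHull ℝ (s : Set (Euc M)) hb
        rw [hA s hs' a ha', hA s hs' b hb']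
        refine (norm_linear_sq_le (A s) a b).trans ?_
        refine mul_le_mul_of_nonneg_right (pow_le_pow_left₀ (norm_nonneg _) ?_ 2) hg
        rw [← dist_eq_norm]
        exact T.dist_le_meshSize hs' ha' hb'
    _ = ((M + 1) * T.meshSize) ^ 2 * g := by
        simp only [Finset.sum_const, hs'.2, nsmul_eq_mul]
        push_cast
        ring

/-- The inverse estimate: the gradient is bounded by the jumps of the nodal values, because every
element contains a ball of radius comparable to the mesh size. -/
lemma gradNorm_sq_le (hΩ : IsPolyhedralLipschitzDomain Ω) {κ : ℝ} (hT : T.IsRegular κ)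
    (h0 : 0 < T.meshSize) {v : C(closure Ω, F)} (hv : v ∈ P1 T F) :
    gradNorm v ^ 2 ≤ M * (κ / T.meshSize) ^ 2 * jumpEnergy T (zeroExt v) := by
  obtain ⟨A, hA⟩ := exists_cell_gradient hv
  rw [gradNorm_sq_eq hΩ hA, jumpEnergy, Finset.mul_sum]
  refine Finset.sum_le_sum fun s hs => ?_
  have hs' := T.mem_cellFinset.1 hs
  rw [mul_left_comm]
  refine mul_le_mul_of_nonneg_left ?_ measureReal_nonneg
  set D := ∑ a ∈ s, ∑ b ∈ s, ‖zeroExt v a - zeroExt v b‖ ^ 2 with hD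
  have hab : ∀ a ∈ s, ∀ b ∈ s, ‖A s a - A s b‖ ≤ Real.sqrt D := by
    intro a ha b hb
    refine Real.le_sqrt_of_sq_le ?_
    rw [← hA s hs' a (subset_convexHull ℝ _ ha), ← hA s hs' b (subset_convexHull ℝ _ hb)]
    refine le_trans ?_ (Finset.single_le_sum (f := fun a => ∑ b ∈ s, ‖zeroExt v a - zeroExt v b‖ ^ 2)
      (fun a _ => by positivity) ha)
    exact Finset.single_le_sum (f := fun b => ‖zeroExt v a - zeroExt v b‖ ^ 2)
      (fun b _ => by positivity) hb
  have hstep : ∀ z : F, (∀ a ∈ s, ‖A s a - z‖ ≤ Real.sqrt D) → ∀ y ∈ hull s,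
      ‖A s y - z‖ ≤ Real.sqrt D := by
    intro z hz y hy
    have hconv : Convex ℝ (A s ⁻¹' closedBall z (Real.sqrt D)) :=
      (convex_closedBall _ _).affine_preimage (A s)
    have := convexHull_min (fun a ha => ?_) hconv hy
    · simpa [dist_eq_norm] using this
    · simpa [dist_eq_norm] using hz a ha
  have hosc : ∀ y ∈ hull s, ∀ z ∈ hull s, ‖A s y - A s z‖ ≤ Real.sqrt D := by
    intro y hy z hz
    refine hstep _ (fun a ha => ?_) y hy
    rw [norm_sub_rev]
    exact hstep _ (fun b hb => hab b hb a ha) z hz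
  obtain ⟨x, r, hsub, hr⟩ := hT.exists_ball s hs'
  have hr1 : T.meshSize / κ ≤ r := by rwa [div_le_iff₀' hT.pos]
  have hr0 : 0 < r := lt_of_lt_of_le (div_pos h0 hT.pos) hr1
  have hDj : ∀ j : Fin M, ‖(A s).linear (EuclideanSpace.single j (1 : ℝ))‖ ^ 2 ≤
      (κ / T.meshSize) ^ 2 * D := by
    intro j
    set e : Euc M := EuclideanSpace.single j (1 : ℝ) with he
    have hen : ‖e‖ = 1 := by simp [he]
    have h1 : ‖A s (x + r • e) - A s x‖ ≤ Real.sqrt D := by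
      refine hosc _ (hsub ?_) _ (hsub (mem_closedBall_self hr0.le))
      simp [norm_smul, hen, abs_of_pos hr0]
    have h2 : A s (x + r • e) - A s x = r • (A s).linear e := by
      rw [← vsub_eq_sub, ← (A s).linearMap_vsub, vsub_eq_sub, add_sub_cancel_left, map_smul]
    rw [h2, norm_smul, Real.norm_eq_abs, abs_of_pos hr0] at h1
    have h3 : ‖(A s).linear e‖ ≤ κ / T.meshSize * Real.sqrt D := by
      have h4 : T.meshSize / κ * ‖(A s).linear e‖ ≤ Real.sqrt D :=
        (mul_le_mul_of_nonneg_right hr1 (norm_nonneg _)).trans h1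
      have hκ := hT.pos
      rw [div_mul_eq_mul_div, div_le_iff₀ hκ] at h4
      rw [div_mul_eq_mul_div, le_div_iff₀ h0]
      linarith
    calc ‖(A s).linear e‖ ^ 2 ≤ (κ / T.meshSize * Real.sqrt D) ^ 2 :=
          pow_le_pow_left₀ (norm_nonneg _) h3 2
      _ = (κ / T.meshSize) ^ 2 * D := by
          rw [mul_pow, Real.sq_sqrt (by positivity)]
  calc ∑ j : Fin M, ‖(A s).linear (EuclideanSpace.single j (1 : ℝ))‖ ^ 2
      ≤ ∑ _j : Fin M, (κ / T.meshSize) ^ 2 * D := Finset.sum_le_sum fun j _ => hDj j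
    _ = M * (κ / T.meshSize) ^ 2 * D := by simp [mul_assoc]

end

section

variable {M : ℕ} {Ω : Set (Euc M)}

/-! ### Averages as nodal values -/

lemma eLpNorm_two_sq {F : Type*} [NormedAddCommGroup F] (f : Euc M → F) (μ : Measure (Euc M)) :
    eLpNorm f 2 μ ^ 2 = ∫⁻ x, ‖f x‖ₑ ^ 2 ∂μ := by
  have h := eLpNorm_nnreal_pow_eq_lintegral (f := f) (μ := μ) (p := 2) (by norm_num)
  simpa only [NNReal.coe_ofNat, ENNReal.rpow_ofNat, ENNReal.coe_ofNat] using h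

lemma lintegral_enorm_sq_eq {F : Type*} [NormedAddCommGroup F] {f : Euc M → F}
    (hf : MemLp f 2 (volume.restrict Ω)) :
    ∫⁻ x in Ω, ‖f x‖ₑ ^ 2 = ENNReal.ofReal (l2Norm Ω f ^ 2) := by
  rw [← eLpNorm_two_sq, l2Norm, ENNReal.ofReal_pow ENNReal.toReal_nonneg,
    ENNReal.ofReal_toReal hf.eLpNorm_ne_top]

/-- A representative that is measurable on the whole space and vanishes outside the domain. -/
lemma exists_measurable_representative (hΩ : IsPolyhedralLipschitzDomain Ω) {F : Type*}
    [NormedAddCommGroup F] {f : Euc M → F} (hf : MemLp f 2 (volume.restrict Ω)) :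
    ∃ g : Euc M → F, StronglyMeasurable g ∧ Integrable g ∧ f =ᵐ[volume.restrict Ω] g ∧
      ∫⁻ x, ‖g x‖ₑ ^ 2 = ENNReal.ofReal (l2Norm Ω f ^ 2) := by
  have := hΩ.isFiniteMeasure_restrict
  have hΩm := hΩ.isOpen.measurableSet
  obtain ⟨k, hk, hfk⟩ := hf.aestronglyMeasurable
  have hki : IntegrableOn k Ω := (hf.integrable (by norm_num)).congr hfk
  refine ⟨Ω.indicator k, hk.indicator hΩm, (integrable_indicator_iff hΩm).2 hki, ?_, ?_⟩
  · filter_upwards [hfk, ae_restrict_mem hΩm] with x hx hxΩ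
    rw [hx, indicator_of_mem hxΩ]
  · rw [← lintegral_enorm_sq_eq hf, ← lintegral_indicator hΩm]
    have h1 : (fun x => ‖Ω.indicator k x‖ₑ ^ 2) = Ω.indicator fun x => ‖k x‖ₑ ^ 2 := by
      ext x
      by_cases hx : x ∈ Ω <;> simp [hx]
    rw [h1, lintegral_indicator hΩm, lintegral_indicator hΩm]
    refine lintegral_congr_ae ?_
    filter_upwards [hfk] with x hx
    rw [hx]

lemma IsWeakGradient.congr {f f' : Euc M → ℝ} {G G' : Euc M → Euc M} (h : IsWeakGradient Ω f G)
    (hf : f =ᵐ[volume.restrict Ω] f') (hG : G =ᵐ[volume.restrict Ω] G') :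
    IsWeakGradient Ω f' G' := by
  intro φ h1 h2 h3 e
  have e1 : ∫ x in Ω, f' x * fderiv ℝ φ x e = ∫ x in Ω, f x * fderiv ℝ φ x e := by
    refine integral_congr_ae ?_
    filter_upwards [hf] with x hx
    rw [hx]
  have e2 : ∫ x in Ω, inner ℝ (G' x) e * φ x = ∫ x in Ω, inner ℝ (G x) e * φ x := by
    refine integral_congr_ae ?_
    filter_upwards [hG] with x hx
    rw [hx]
  rw [e1, e2]
  exact h φ h1 h2 h3 e

/-- The mean value is at least as close to a number as the function is in quadratic mean. -/
lemma enorm_sub_average_sq_le {E : Set (Euc M)} {f : Euc M → ℝ} (hf : Integrable f)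
    (hfm : Measurable f) (hE0 : volume E ≠ 0) (hE1 : volume E ≠ ⊤) (t : ℝ) :
    ‖t - (volume.real E)⁻¹ * ∫ y in E, f y‖ₑ ^ 2 ≤
      (volume E)⁻¹ * ∫⁻ y in E, ‖t - f y‖ₑ ^ 2 := by
  have : IsFiniteMeasure (volume.restrict E) := isFiniteMeasure_restrict.2 hE1
  have hr : volume.real E ≠ 0 := (ENNReal.toReal_pos hE0 hE1).ne'
  have h1 : t - (volume.real E)⁻¹ * ∫ y in E, f y =
      (volume.real E)⁻¹ * ∫ y in E, (t - f y) := by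
    rw [integral_sub (integrable_const _) hf.integrableOn, setIntegral_const, smul_eq_mul,
      mul_sub, inv_mul_cancel_left₀ hr]
  have h2 : ‖(volume.real E)⁻¹‖ₑ = (volume E)⁻¹ := by
    rw [enorm_inv hr, Measure.real, Real.enorm_of_nonneg ENNReal.toReal_nonneg,
      ENNReal.ofReal_toReal hE1]
  rw [h1, enorm_mul, mul_pow, h2]
  refine (mul_le_mul_right (enorm_integral_sq_le
    (measurable_const.sub hfm).aestronglyMeasurable) _).trans (le_of_eq ?_)
  rw [Measure.restrict_apply_univ, sq, ← mul_assoc, mul_assoc _ _ (volume E),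
    ENNReal.inv_mul_cancel hE0 hE1, mul_one]
  rfl

lemma Triangulation.ae_mem_of_hull (T : Triangulation Ω) (hΩ : IsPolyhedralLipschitzDomain Ω)
    {s : Finset (Euc M)} (hs : s ∈ T.cells) : ∀ᵐ x ∂volume.restrict (hull s), x ∈ Ω := by
  have h : ∀ᵐ x ∂volume.restrict (closure Ω), x ∈ Ω := by
    rw [hΩ.restrict_closure]
    exact ae_restrict_mem hΩ.isOpen.measurableSet
  exact ae_restrict_of_ae_restrict_of_subset (T.hull_subset hs) h

/-- Replacing a function on every element by its averages over balls of radius `h` around the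
vertices costs at most `h` times the `H¹` norm. The averages of nearby points are compared through
translations, so that the estimate reduces to the `L²` modulus of continuity. -/
lemma exists_nodal_average_bound (hΩ : IsPolyhedralLipschitzDomain Ω) (hM : 0 < M) {κ : ℝ}
    (hκ : 0 < κ) :
    ∃ C : ℝ, 0 ≤ C ∧ ∀ T : Triangulation Ω, T.IsRegular κ → ∀ (f : Euc M → ℝ) (G : Euc M → Euc M),
      MemH1Linf Ω f G → ∃ J : Euc M → ℝ,
        ∑ s ∈ T.cellFinset, ∑ a ∈ s, ∫ x in hull s, (f x - J a) ^ 2 ≤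
          C * T.meshSize ^ 2 * (l2Norm Ω f ^ 2 + l2Norm Ω G ^ 2) := by
  obtain ⟨C, hC⟩ := hΩ.exists_translate_bound
  refine ⟨(M + 1) * (2 * κ) ^ M * (4 * C), by positivity, fun T hT f G hfG => ?_⟩
  have := hΩ.isFiniteMeasure_restrict
  have hΩm := hΩ.isOpen.measurableSet
  set h := T.meshSize with hh
  have h0 : 0 < h := T.meshSize_pos hΩ hM
  obtain ⟨f₀, hf₀m, hf₀i, hff₀, hf₀n⟩ := exists_measurable_representative hΩ hfG.memLp_two
  obtain ⟨G₀, hG₀m, hG₀i, hGG₀, hG₀n⟩ := exists_measurable_representative hΩ hfG.memLp_grad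
  have hw : IsWeakGradient Ω f₀ G₀ := hfG.isWeakGradient.congr hff₀ hGG₀
  set H := l2Norm Ω f ^ 2 + l2Norm Ω G ^ 2 with hH
  have hH0 : 0 ≤ H := by positivity
  have htr := hC f₀ G₀ hf₀m.measurable hf₀i hG₀m hG₀i hw
  rw [hf₀n, hG₀n, ← ENNReal.ofReal_add (by positivity) (by positivity), ← hH] at htr
  set E : Euc M → Set (Euc M) := fun a => Ω ∩ closedBall a h with hE
  set J : Euc M → ℝ := fun a => (volume.real (E a))⁻¹ * ∫ y in E a, f₀ y with hJ
  refine ⟨J, ?_⟩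
  -- the squared difference quotient, seen as a function of the point and the translation
  set Q : Euc M → Euc M → ℝ≥0∞ := fun x v =>
    {x | x ∈ Ω ∧ x + v ∈ Ω}.indicator (fun x => ‖f₀ (x + v) - f₀ x‖ₑ ^ 2) x with hQ
  have hQset : ∀ v, MeasurableSet {x | x ∈ Ω ∧ x + v ∈ Ω} := fun v =>
    hΩm.inter (hΩm.preimage (by fun_prop : Measurable fun x => x + v))
  have hQm : Measurable (Function.uncurry Q) := by
    have hS : MeasurableSet {p : Euc M × Euc M | p.1 ∈ Ω ∧ p.1 + p.2 ∈ Ω} :=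
      (hΩm.preimage measurable_fst).inter
        (hΩm.preimage (by fun_prop : Measurable fun p : Euc M × Euc M => p.1 + p.2))
    have hf₀' := hf₀m.measurable
    have : Measurable fun p : Euc M × Euc M => ‖f₀ (p.1 + p.2) - f₀ p.1‖ₑ ^ 2 := by fun_prop
    exact this.indicator hS
  set B : Set (Euc M) := closedBall 0 (2 * h) with hB
  set Φ : Euc M → ℝ≥0∞ := fun x => ∫⁻ v in B, Q x v with hΦ
  set c := unitVol M * (h / κ) ^ M with hc
  have hc0 : 0 < c := mul_pos unitVol_pos (pow_pos (div_pos h0 hκ) M)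
  have hloc : ∀ s ∈ T.cells, ∀ a ∈ s,
      ∫⁻ x in hull s, ‖f₀ x - J a‖ₑ ^ 2 ≤ ENNReal.ofReal c⁻¹ * ∫⁻ x in hull s, Φ x := by
    intro s hs a ha
    have hahull : a ∈ hull s := subset_convexHull ℝ _ ha
    have hEtop : volume (E a) ≠ ⊤ :=
      measure_ne_top_of_subset inter_subset_left hΩ.isBounded.measure_lt_top.ne
    have hEc : ENNReal.ofReal c ≤ volume (E a) := by
      have h1 : volume (hull s) = volume (hull s ∩ Ω) := by
        refine (measure_congr ?_).symm
        have := (ae_restrict_iff' (Triangulation.measurableSet_hull s)).1 (T.ae_mem_of_hull hΩ hs)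
        filter_upwards [this] with x hx
        exact propext ⟨fun hx' => hx'.1, fun hx' => ⟨hx', hx hx'⟩⟩
      have h2 : ENNReal.ofReal c ≤ volume (hull s) := by
        rw [ENNReal.ofReal_le_iff_le_toReal (Triangulation.volume_hull_ne_top s)]
        exact hT.le_volume hs h0
      rw [h1] at h2
      refine h2.trans (measure_mono fun x hx => ⟨hx.2, ?_⟩)
      exact T.dist_le_meshSize hs hx.1 hahull
    have hE0 : volume (E a) ≠ 0 := (lt_of_lt_of_le (ENNReal.ofReal_pos.2 hc0) hEc).ne'
    have hinv : (volume (E a))⁻¹ ≤ ENNReal.ofReal c⁻¹ := by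
      rw [ENNReal.ofReal_inv_of_pos hc0]
      exact ENNReal.inv_le_inv.2 hEc
    rw [← lintegral_const_mul' _ _ ENNReal.ofReal_ne_top]
    refine lintegral_mono_ae ?_
    filter_upwards [T.ae_mem_of_hull hΩ hs,
      ae_restrict_mem (Triangulation.measurableSet_hull s)] with x hxΩ hxs
    refine (enorm_sub_average_sq_le hf₀i hf₀m.measurable hE0 hEtop (f₀ x)).trans ?_
    refine mul_le_mul' hinv ?_
    have hsub : ∀ v, x + v ∈ E a → v ∈ B := by
      intro v hv
      have h1 : dist (x + v) a ≤ h := hv.2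
      have h2 := T.dist_le_meshSize hs hahull hxs
      have h3 := dist_triangle (x + v) a x
      rw [hB, mem_closedBall_zero_iff]
      rw [dist_eq_norm (x + v) x, add_sub_cancel_left] at h3
      linarith
    calc ∫⁻ y in E a, ‖f₀ x - f₀ y‖ₑ ^ 2
        = ∫⁻ v in (x + ·) ⁻¹' E a, ‖f₀ x - f₀ (x + v)‖ₑ ^ 2 :=
          ((measurePreserving_add_left volume x).setLIntegral_comp_preimage_emb
            (MeasurableEquiv.addLeft x).measurableEmbedding (fun y => ‖f₀ x - f₀ y‖ₑ ^ 2) _).symm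
      _ ≤ ∫⁻ v in (x + ·) ⁻¹' E a, Q x v := by
          refine setLIntegral_mono' ?_ fun v hv => ?_
          · exact (hΩm.inter isClosed_closedBall.measurableSet).preimage (by fun_prop)
          · have hmem : x ∈ {x | x ∈ Ω ∧ x + v ∈ Ω} := ⟨hxΩ, hv.1⟩
            simp only [hQ, indicator_of_mem hmem]
            rw [← enorm_neg, neg_sub]
      _ ≤ Φ x := lintegral_mono_set hsub
  have hΦΩ : ∫⁻ x in Ω, Φ x ≤
      ENNReal.ofReal ((2 * h) ^ M * unitVol M * (C * (2 * h) ^ 2 * H)) := by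
    calc ∫⁻ x in Ω, Φ x ≤ ∫⁻ x, Φ x := lintegral_mono' Measure.restrict_le_self le_rfl
      _ = ∫⁻ v in B, ∫⁻ x, Q x v := lintegral_lintegral_swap hQm.aemeasurable
      _ ≤ ∫⁻ v in B, ENNReal.ofReal (C * (2 * h) ^ 2 * H) := by
          refine setLIntegral_mono' isClosed_closedBall.measurableSet fun v hv => ?_
          rw [hB, mem_closedBall_zero_iff] at hv
          rw [hQ]
          simp only
          rw [lintegral_indicator (hQset v)]
          refine (htr v).trans ?_
          rw [ENNReal.ofReal_mul (by positivity), ENNReal.ofReal_mul (by positivity),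
            ENNReal.ofReal_pow (by positivity), ENNReal.ofReal_coe_nnreal, ← ofReal_norm]
          gcongr
      _ = ENNReal.ofReal ((2 * h) ^ M * unitVol M * (C * (2 * h) ^ 2 * H)) := by
          rw [setLIntegral_const, hB, Measure.addHaar_closedBall volume _ (by positivity),
            finrank_euclideanSpace_fin,
            ENNReal.ofReal_mul (p := (2 * h) ^ M * unitVol M)
              (mul_nonneg (by positivity) unitVol_pos.le),
            ENNReal.ofReal_mul (p := (2 * h) ^ M) (by positivity), unitVol, Measure.real,
            ENNReal.ofReal_toReal measure_ball_lt_top.ne]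
          ring
  have hint : ∀ s ∈ T.cells, ∀ a, IntegrableOn (fun x => (f x - J a) ^ 2) (hull s) := by
    intro s hs a
    have h1 : MemLp (fun x => f x - J a) 2 (volume.restrict Ω) :=
      hfG.memLp_two.sub (memLp_const _)
    exact T.integrableOn_hull hΩ h1.integrable_sq hs
  have hconv : ∀ s ∈ T.cells, ∀ a, ENNReal.ofReal (∫ x in hull s, (f x - J a) ^ 2) =
      ∫⁻ x in hull s, ‖f₀ x - J a‖ₑ ^ 2 := by
    intro s hs a
    rw [ofReal_integral_eq_lintegral_ofReal (hint s hs a) (ae_of_all _ fun x => sq_nonneg _)]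
    have h1 : f =ᵐ[volume.restrict (closure Ω)] f₀ := by rwa [hΩ.restrict_closure]
    refine lintegral_congr_ae ?_
    filter_upwards [ae_restrict_of_ae_restrict_of_subset (T.hull_subset hs) h1] with x hx
    rw [hx, enorm_sq_eq_ofReal]
  rw [← ENNReal.ofReal_le_ofReal_iff (by positivity)]
  calc ENNReal.ofReal (∑ s ∈ T.cellFinset, ∑ a ∈ s, ∫ x in hull s, (f x - J a) ^ 2)
      = ∑ s ∈ T.cellFinset, ∑ a ∈ s, ∫⁻ x in hull s, ‖f₀ x - J a‖ₑ ^ 2 := by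
        have hnn : ∀ (s : Finset (Euc M)) (a : Euc M), 0 ≤ ∫ x in hull s, (f x - J a) ^ 2 :=
          fun s a => integral_nonneg fun x => sq_nonneg _
        rw [ENNReal.ofReal_sum_of_nonneg fun s _ => Finset.sum_nonneg fun a _ => hnn s a]
        refine Finset.sum_congr rfl fun s hs => ?_
        rw [ENNReal.ofReal_sum_of_nonneg fun a _ => hnn s a]
        exact Finset.sum_congr rfl fun a _ => hconv s (T.mem_cellFinset.1 hs) a
    _ ≤ ∑ s ∈ T.cellFinset, ∑ _a ∈ s, ENNReal.ofReal c⁻¹ * ∫⁻ x in hull s, Φ x :=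
        Finset.sum_le_sum fun s hs => Finset.sum_le_sum fun a ha =>
          hloc s (T.mem_cellFinset.1 hs) a ha
    _ = ∑ s ∈ T.cellFinset, ENNReal.ofReal ((M + 1) * c⁻¹) * ∫⁻ x in hull s, Φ x := by
        refine Finset.sum_congr rfl fun s hs => ?_
        rw [Finset.sum_const, (T.mem_cellFinset.1 hs).2, ENNReal.ofReal_mul (by positivity),
          nsmul_eq_mul, mul_assoc]
        congr 1
        exact_mod_cast (ENNReal.ofReal_natCast (M + 1)).symm
    _ = ENNReal.ofReal ((M + 1) * c⁻¹) * ∫⁻ x in Ω, Φ x := by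
        rw [← Finset.mul_sum, ← T.lintegral_eq_sum hΩ]
    _ ≤ ENNReal.ofReal ((M + 1) * c⁻¹) *
          ENNReal.ofReal ((2 * h) ^ M * unitVol M * (C * (2 * h) ^ 2 * H)) := by gcongr
    _ = ENNReal.ofReal ((M + 1) * (2 * κ) ^ M * (4 * C) * h ^ 2 * H) := by
        rw [← ENNReal.ofReal_mul (by positivity)]
        congr 1
        have hu := (unitVol_pos (M := M)).ne'
        rw [hc, div_pow, mul_pow, mul_pow]
        field_simp
        ring

end

section

variable {M : ℕ} {Ω : Set (Euc M)} {T : Triangulation Ω}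

/-! ### The `L²` projection and its stability in `H¹` -/

lemma zeroExt_add (v w : C(closure Ω, ℝ)) (x : Euc M) :
    zeroExt (v + w) x = zeroExt v x + zeroExt w x := by
  by_cases hx : x ∈ closure Ω
  · simp [zeroExt_of_mem _ hx]
  · have h : ¬∃ y : closure Ω, (y : Euc M) = x := fun ⟨y, hy⟩ => hx (hy ▸ y.2)
    simp [zeroExt, Function.extend_apply' _ _ _ h]

lemma zeroExt_smul (c : ℝ) (v : C(closure Ω, ℝ)) (x : Euc M) :
    zeroExt (c • v) x = c * zeroExt v x := by
  by_cases hx : x ∈ closure Ω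
  · simp [zeroExt_of_mem _ hx]
  · have h : ¬∃ y : closure Ω, (y : Euc M) = x := fun ⟨y, hy⟩ => hx (hy ▸ y.2)
    simp [zeroExt, Function.extend_apply' _ _ _ h]

lemma zeroExt_sub (v w : C(closure Ω, ℝ)) (x : Euc M) :
    zeroExt (v - w) x = zeroExt v x - zeroExt w x := by
  have h := zeroExt_add v ((-1 : ℝ) • w) x
  rw [zeroExt_smul] at h
  rw [sub_eq_add_neg v w, ← neg_one_smul ℝ w, h]
  ring

/-- The constant in the lower bound of the mass matrix. -/
noncomputable def massConst (M : ℕ) : ℝ := (M + 1) * 4 ^ (M + 1)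

lemma massConst_pos : 0 < massConst M := by unfold massConst; positivity

lemma sum_volume_mul_sq_le (hΩ : IsPolyhedralLipschitzDomain Ω) {w : C(closure Ω, ℝ)}
    (hw : w ∈ P1 T ℝ) :
    ∑ s ∈ T.cellFinset, volume.real (hull s) * ∑ a ∈ s, zeroExt w a ^ 2 ≤
      massConst M * ∫ x in Ω, zeroExt w x ^ 2 := by
  rw [T.integral_eq_sum hΩ (memLp_zeroExt hΩ w 2).integrable_sq, Finset.mul_sum]
  exact Finset.sum_le_sum fun s hs => volume_mul_sum_sq_le hΩ hw (T.mem_cellFinset.1 hs)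

lemma integrable_mul_zeroExt (hΩ : IsPolyhedralLipschitzDomain Ω) {f : Euc M → ℝ}
    (hf : MemLp f 2 (volume.restrict Ω)) (v : C(closure Ω, ℝ)) :
    IntegrableOn (fun x => f x * zeroExt v x) Ω :=
  hf.integrable_mul (memLp_zeroExt hΩ v 2)

/-- Finite element functions are determined by finitely many nodal values. -/
instance finiteDimensional_P1 : FiniteDimensional ℝ (P1 T ℝ) := by
  have : Finite T.nodes := T.finite_nodes.to_subtype
  let e : P1 T ℝ →ₗ[ℝ] (T.nodes → ℝ) :=
    { toFun := fun v a => zeroExt v.1 a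
      map_add' := fun v w => by ext a; exact zeroExt_add v.1 w.1 a
      map_smul' := fun c v => by ext a; exact zeroExt_smul c v.1 a }
  refine FiniteDimensional.of_injective e fun v w h => Subtype.ext (P1_ext T v.2 w.2 fun a ha => ?_)
  have := congrFun h ⟨a, ha⟩
  rwa [← zeroExt_coe, ← zeroExt_coe]

/-- The `L²` projection onto the finite element space. -/
lemma exists_l2_projection (hΩ : IsPolyhedralLipschitzDomain Ω) {κ : ℝ} (hT : T.IsRegular κ)
    (h0 : 0 < T.meshSize) {f : Euc M → ℝ} (hf : MemLp f 2 (volume.restrict Ω)) :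
    ∃ w ∈ P1 T ℝ, ∀ χ ∈ P1 T ℝ,
      ∫ x in Ω, zeroExt w x * zeroExt χ x = ∫ x in Ω, f x * zeroExt χ x := by
  have hi := fun (v w : C(closure Ω, ℝ)) => integrable_mul_zeroExt hΩ (memLp_zeroExt hΩ v 2) w
  have hif := integrable_mul_zeroExt hΩ hf
  let B : P1 T ℝ →ₗ[ℝ] Module.Dual ℝ (P1 T ℝ) :=
    LinearMap.mk₂ ℝ (fun v w => ∫ x in Ω, zeroExt v.1 x * zeroExt w.1 x)
      (fun u v w => by
        rw [← integral_add (hi _ _) (hi _ _)]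
        simp [zeroExt_add, add_mul])
      (fun c v w => by
        rw [smul_eq_mul, ← integral_const_mul]
        simp [zeroExt_smul, mul_assoc])
      (fun u v w => by
        rw [← integral_add (hi _ _) (hi _ _)]
        simp [zeroExt_add, mul_add])
      (fun c v w => by
        rw [smul_eq_mul, ← integral_const_mul]
        simp [zeroExt_smul, mul_left_comm])
  let ℓ : Module.Dual ℝ (P1 T ℝ) :=
    { toFun := fun w => ∫ x in Ω, f x * zeroExt w.1 x
      map_add' := fun v w => by
        rw [← integral_add (hif _) (hif _)]
        simp [zeroExt_add, mul_add]
      map_smul' := fun c w => by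
        rw [RingHom.id_apply, smul_eq_mul, ← integral_const_mul]
        simp [zeroExt_smul, mul_left_comm] }
  have hinj : Function.Injective B := by
    rw [injective_iff_map_eq_zero]
    intro v hv
    have h1 : ∫ x in Ω, zeroExt v.1 x ^ 2 = 0 := by
      have := LinearMap.congr_fun hv v
      simpa [B, sq] using this
    have h2 := sum_volume_mul_sq_le hΩ v.2
    rw [h1, mul_zero] at h2
    refine Subtype.ext (P1_ext T v.2 (Submodule.zero_mem _) fun a ha => ?_)
    obtain ⟨s, hs, has⟩ := T.exists_cell_of_mem_nodes ha
    have hnn : ∀ s : Finset (Euc M), 0 ≤ ∑ a ∈ s, zeroExt v.1 a ^ 2 := fun s =>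
      Finset.sum_nonneg fun a _ => sq_nonneg _
    have h3 := (Finset.sum_eq_zero_iff_of_nonneg fun s _ =>
      mul_nonneg measureReal_nonneg (hnn s)).1
      (le_antisymm h2 (Finset.sum_nonneg fun s _ => mul_nonneg measureReal_nonneg (hnn s))) s
      (T.mem_cellFinset.2 hs)
    have h4 := (mul_eq_zero.1 h3).resolve_left (hT.volume_pos hs h0).ne'
    have h5 := (Finset.sum_eq_zero_iff_of_nonneg fun a _ => sq_nonneg _).1 h4 a has
    have h6 : zeroExt v.1 (a : Euc M) = 0 := by simpa using h5
    rw [zeroExt_coe] at h6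
    simpa using h6
  have hsurj := (LinearMap.injective_iff_surjective_of_finrank_eq_finrank
    (Subspace.dual_finrank_eq (K := ℝ) (V := P1 T ℝ)).symm).1 hinj
  obtain ⟨w, hw⟩ := hsurj ℓ
  exact ⟨w.1, w.2, fun χ hχ => LinearMap.congr_fun hw ⟨χ, hχ⟩⟩

lemma sq_sum_weights_le {s : Finset (Euc M)} {l z : Euc M → ℝ} (h0 : ∀ a ∈ s, 0 ≤ l a)
    (h1 : ∑ a ∈ s, l a = 1) : (∑ a ∈ s, l a * z a) ^ 2 ≤ ∑ a ∈ s, z a ^ 2 := by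
  have h := Finset.sum_sq_le_sum_mul_sum_of_sq_le_mul s h0
    (g := fun a => l a * z a ^ 2) (r := fun a => l a * z a)
    (fun a ha => mul_nonneg (h0 a ha) (sq_nonneg _)) (fun a _ => le_of_eq (by ring))
  rw [h1, one_mul] at h
  refine h.trans (Finset.sum_le_sum fun a ha => mul_le_of_le_one_left (sq_nonneg _) ?_)
  rw [← h1]
  exact Finset.single_le_sum h0 ha

/-- The projection does not oscillate more than the best approximation of the function by numbers
at the vertices. -/
lemma jumpEnergy_l2_projection_le (hΩ : IsPolyhedralLipschitzDomain Ω) {f : Euc M → ℝ}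
    (hf : MemLp f 2 (volume.restrict Ω)) {w : C(closure Ω, ℝ)} (hw : w ∈ P1 T ℝ)
    (hproj : ∀ χ ∈ P1 T ℝ, ∫ x in Ω, zeroExt w x * zeroExt χ x = ∫ x in Ω, f x * zeroExt χ x)
    (J : Euc M → ℝ) :
    jumpEnergy T (zeroExt w) ≤ 6 * (M + 1) * (massConst M + 2) *
      ∑ s ∈ T.cellFinset, ∑ a ∈ s, ∫ x in hull s, (f x - J a) ^ 2 := by
  have hfin := hΩ.isFiniteMeasure_restrict
  obtain ⟨z, hz, hzJ⟩ := exists_mem_P1_eq_on_nodes T J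
  set S := ∑ s ∈ T.cellFinset, ∑ a ∈ s, ∫ x in hull s, (f x - J a) ^ 2 with hS
  have hfJ : ∀ s ∈ T.cells, ∀ a, IntegrableOn (fun x => (f x - J a) ^ 2) (hull s) := by
    intro s hs a
    exact T.integrableOn_hull hΩ (hf.sub (memLp_const (J a))).integrable_sq hs
  have hfz : MemLp (fun x => f x - zeroExt z x) 2 (volume.restrict Ω) :=
    hf.sub (memLp_zeroExt hΩ z 2)
  have hz1 : ∫ x in Ω, (f x - zeroExt z x) ^ 2 ≤ S := by
    rw [T.integral_eq_sum hΩ hfz.integrable_sq]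
    refine Finset.sum_le_sum fun s hs => ?_
    have hs' := T.mem_cellFinset.1 hs
    rw [← integral_finsetSum s fun a _ => hfJ s hs' a]
    refine setIntegral_mono_on (T.integrableOn_hull hΩ hfz.integrable_sq hs')
      (integrable_finsetSum s fun a _ => hfJ s hs' a) (Triangulation.measurableSet_hull s)
      fun x hx => ?_
    obtain ⟨l, h0, h1, hl⟩ := exists_weights hs' hx
    have h2 : f x - zeroExt z x = ∑ a ∈ s, l a * (f x - J a) := by
      simp only [mul_sub, Finset.sum_sub_distrib, ← Finset.sum_mul, h1, one_mul]
      rw [hl z hz]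
      congr 1
      exact Finset.sum_congr rfl fun a ha => by rw [hzJ a (T.mem_nodes_of_mem hs' ha)]
    rw [h2]
    exact sq_sum_weights_le h0 h1
  have hwz : ∫ x in Ω, zeroExt (w - z) x ^ 2 ≤ ∫ x in Ω, (f x - zeroExt z x) ^ 2 := by
    have hd := (P1 T ℝ).sub_mem hw hz
    have e1 : ∫ x in Ω, zeroExt (w - z) x ^ 2 =
        ∫ x in Ω, (f x - zeroExt z x) * zeroExt (w - z) x := by
      have h1 := hproj _ hd
      have i1 := integrable_mul_zeroExt hΩ (memLp_zeroExt hΩ w 2) (w - z)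
      have i2 := integrable_mul_zeroExt hΩ (memLp_zeroExt hΩ z 2) (w - z)
      have i3 := integrable_mul_zeroExt hΩ hf (w - z)
      have h2 : ∫ x in Ω, (zeroExt w x * zeroExt (w - z) x - zeroExt z x * zeroExt (w - z) x) =
          ∫ x in Ω, (f x * zeroExt (w - z) x - zeroExt z x * zeroExt (w - z) x) := by
        rw [integral_sub i1 i2, integral_sub i3 i2, h1]
      simp only [← sub_mul] at h2
      rw [← h2]
      congr 1
      ext x
      rw [← zeroExt_sub, sq]
    have i4 := (memLp_zeroExt hΩ (w - z) 2).integrable_sq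
    have h3 : ∫ x in Ω, (f x - zeroExt z x) * zeroExt (w - z) x ≤
        ∫ x in Ω, (1 / 2 * (f x - zeroExt z x) ^ 2 + 1 / 2 * zeroExt (w - z) x ^ 2) := by
      refine integral_mono (integrable_mul_zeroExt hΩ hfz _)
        ((hfz.integrable_sq.const_mul _).add (i4.const_mul _)) fun x => ?_
      simp only
      nlinarith [sq_nonneg (f x - zeroExt z x - zeroExt (w - z) x)]
    rw [integral_add (hfz.integrable_sq.const_mul _) (i4.const_mul _), integral_const_mul,
      integral_const_mul] at h3
    linarith
  have hD := sum_volume_mul_sq_le hΩ ((P1 T ℝ).sub_mem hw hz)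
  have hD' : ∑ s ∈ T.cellFinset, volume.real (hull s) * ∑ a ∈ s, (zeroExt w a - J a) ^ 2 ≤
      massConst M * S := by
    refine le_trans (le_of_eq ?_) (hD.trans (mul_le_mul_of_nonneg_left (hwz.trans hz1)
      massConst_pos.le))
    refine Finset.sum_congr rfl fun s hs => ?_
    congr 1
    refine Finset.sum_congr rfl fun a ha => ?_
    rw [zeroExt_sub, hzJ a (T.mem_nodes_of_mem (T.mem_cellFinset.1 hs) ha)]
  -- on each element the jumps of `w` split into those of `w - J` and those of `J`
  have hcell : ∀ s ∈ T.cellFinset,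
      volume.real (hull s) * ∑ a ∈ s, ∑ b ∈ s, ‖zeroExt w a - zeroExt w b‖ ^ 2 ≤
        6 * (M + 1) * (volume.real (hull s) * ∑ a ∈ s, (zeroExt w a - J a) ^ 2) +
          12 * (M + 1) * ∑ a ∈ s, ∫ x in hull s, (f x - J a) ^ 2 := by
    intro s hs
    have hs' := T.mem_cellFinset.1 hs
    set I : Euc M → ℝ := fun a => ∫ x in hull s, (f x - J a) ^ 2 with hI
    have hJJ : ∀ a b, volume.real (hull s) * (J a - J b) ^ 2 ≤ 2 * I a + 2 * I b := by
      intro a b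
      have h1 : ∫ x in hull s, (J a - J b) ^ 2 ≤
          ∫ x in hull s, (2 * (f x - J a) ^ 2 + 2 * (f x - J b) ^ 2) := by
        refine integral_mono (integrableOn_const (Triangulation.volume_hull_ne_top s))
          (((hfJ s hs' a).const_mul _).add ((hfJ s hs' b).const_mul _)) fun x => ?_
        simp only
        nlinarith [sq_nonneg ((f x - J a) + (f x - J b))]
      rwa [setIntegral_const, smul_eq_mul, integral_add ((hfJ s hs' a).const_mul _)
        ((hfJ s hs' b).const_mul _), integral_const_mul, integral_const_mul] at h1
    have hab : ∀ a b, volume.real (hull s) * ‖zeroExt w a - zeroExt w b‖ ^ 2 ≤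
        3 * (volume.real (hull s) * (zeroExt w a - J a) ^ 2) +
          3 * (volume.real (hull s) * (zeroExt w b - J b) ^ 2) + (6 * I a + 6 * I b) := by
      intro a b
      have h1 : ‖zeroExt w a - zeroExt w b‖ ^ 2 ≤ 3 * (zeroExt w a - J a) ^ 2 +
          3 * (zeroExt w b - J b) ^ 2 + 3 * (J a - J b) ^ 2 := by
        rw [Real.norm_eq_abs, sq_abs]
        nlinarith [sq_nonneg ((zeroExt w a - J a) + (zeroExt w b - J b)),
          sq_nonneg ((zeroExt w a - J a) - (J a - J b)),
          sq_nonneg ((zeroExt w b - J b) + (J a - J b))]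
      have h2 := mul_le_mul_of_nonneg_left h1 (measureReal_nonneg (μ := volume) (s := hull s))
      linarith [hJJ a b]
    calc volume.real (hull s) * ∑ a ∈ s, ∑ b ∈ s, ‖zeroExt w a - zeroExt w b‖ ^ 2
        = ∑ a ∈ s, ∑ b ∈ s, volume.real (hull s) * ‖zeroExt w a - zeroExt w b‖ ^ 2 := by
          simp only [Finset.mul_sum]
      _ ≤ ∑ a ∈ s, ∑ b ∈ s, (3 * (volume.real (hull s) * (zeroExt w a - J a) ^ 2) +
          3 * (volume.real (hull s) * (zeroExt w b - J b) ^ 2) + (6 * I a + 6 * I b)) :=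
          Finset.sum_le_sum fun a _ => Finset.sum_le_sum fun b _ => hab a b
      _ = _ := by
          simp only [Finset.sum_add_distrib, Finset.sum_const, hs'.2, ← Finset.mul_sum,
            nsmul_eq_mul]
          push_cast
          ring
  calc jumpEnergy T (zeroExt w) ≤ _ := Finset.sum_le_sum hcell
    _ = 6 * (M + 1) * (∑ s ∈ T.cellFinset, volume.real (hull s) *
          ∑ a ∈ s, (zeroExt w a - J a) ^ 2) + 12 * (M + 1) * S := by
        rw [Finset.sum_add_distrib, ← Finset.mul_sum, ← Finset.mul_sum]
    _ ≤ 6 * (M + 1) * (massConst M * S) + 12 * (M + 1) * S := by gcongr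
    _ = _ := by ring

end

section

variable {M : ℕ} {Ω : Set (Euc M)} {T : Triangulation Ω}

/-! ### Stability of the `L²` projection in `L^∞` -/

/-- A weight that decays away from `a` on the scale `1/δ`. Over distances at most `h` it varies at
most by the factor `(1 + δ h) ^ M`; with the exponent `M` its square is integrable. -/
noncomputable def decay (δ : ℝ) (a x : Euc M) : ℝ := ((1 + δ * ‖x - a‖) ^ M)⁻¹

lemma decay_pos {δ : ℝ} (hδ : 0 ≤ δ) (a x : Euc M) : 0 < decay δ a x := by
  unfold decay; positivity

lemma decay_self (δ : ℝ) (a : Euc M) : decay δ a a = 1 := by simp [decay]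

lemma decay_le {δ h ε : ℝ} (hδ : 0 ≤ δ) (hε : δ * h ≤ ε) (a : Euc M) {x y : Euc M}
    (hxy : dist x y ≤ h) : decay δ a x ≤ (1 + ε) ^ M * decay δ a y := by
  have hx : 0 < 1 + δ * ‖x - a‖ := by positivity
  have hy : 0 < 1 + δ * ‖y - a‖ := by positivity
  have hε0 : 0 ≤ ε := (mul_nonneg hδ (dist_nonneg.trans hxy)).trans hε
  have h1 : 1 + δ * ‖y - a‖ ≤ (1 + ε) * (1 + δ * ‖x - a‖) := by
    have h2 : ‖y - a‖ ≤ ‖x - a‖ + h := by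
      have := norm_sub_le_norm_sub_add_norm_sub y x a
      rw [dist_comm, dist_eq_norm] at hxy
      linarith
    have h3 := mul_le_mul_of_nonneg_left h2 hδ
    have h4 : 0 ≤ ε * (δ * ‖x - a‖) := by positivity
    nlinarith
  have h5 := pow_le_pow_left₀ hy.le h1 M
  rw [mul_pow] at h5
  unfold decay
  rw [← div_eq_mul_inv, le_div_iff₀ (pow_pos hy M), inv_mul_le_iff₀ (pow_pos hx M)]
  linarith

/-- The integral of the square of the unscaled weight. -/
noncomputable def decayConst (M : ℕ) : ℝ := ∫ x : Euc M, ((1 + ‖x‖) ^ M)⁻¹ ^ 2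

lemma integrable_decay_unscaled (hM : 0 < M) :
    Integrable fun x : Euc M => ((1 + ‖x‖) ^ M)⁻¹ ^ 2 := by
  have h := integrable_one_add_norm (E := Euc M) (μ := volume) (r := (2 * M : ℕ)) (by
    rw [finrank_euclideanSpace_fin]
    exact_mod_cast (by omega : M < 2 * M))
  refine h.congr (ae_of_all _ fun x => ?_)
  simp only
  rw [Real.rpow_neg (by positivity), Real.rpow_natCast, inv_pow, ← pow_mul, mul_comm]

lemma decayConst_nonneg : 0 ≤ decayConst M := integral_nonneg fun _ => by positivity

lemma decay_sq_eq {δ : ℝ} (hδ : 0 < δ) (a x : Euc M) :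
    decay δ a x ^ 2 = (fun y : Euc M => ((1 + ‖y‖) ^ M)⁻¹ ^ 2) (δ • (x - a)) := by
  simp [decay, norm_smul, abs_of_pos hδ]

lemma integrable_decay_sq (hM : 0 < M) {δ : ℝ} (hδ : 0 < δ) (a : Euc M) :
    Integrable fun x => decay δ a x ^ 2 := by
  simp only [decay_sq_eq hδ]
  exact ((integrable_decay_unscaled hM).comp_smul hδ.ne').comp_sub_right a

lemma integral_decay_sq {δ : ℝ} (hδ : 0 < δ) (a : Euc M) :
    ∫ x, decay δ a x ^ 2 = (δ ^ M)⁻¹ * decayConst M := by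
  simp only [decay_sq_eq hδ]
  rw [integral_sub_right_eq_self
      (fun x : Euc M => (fun y : Euc M => ((1 + ‖y‖) ^ M)⁻¹ ^ 2) (δ • x)) a,
    Measure.integral_comp_smul volume (fun y : Euc M => ((1 + ‖y‖) ^ M)⁻¹ ^ 2) δ,
    finrank_euclideanSpace_fin, abs_of_pos (by positivity), smul_eq_mul]
  rfl

lemma exists_one_add_pow_le (n : ℕ) {η : ℝ} (hη : 0 < η) : ∃ ε : ℝ, 0 < ε ∧ ε ≤ 1 ∧
    (1 + ε) ^ n ≤ 1 + η := by
  have hc : ContinuousAt (fun ε : ℝ => (1 + ε) ^ n) 0 := by fun_prop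
  have h1 : ∀ᶠ ε in nhds (0 : ℝ), (1 + ε) ^ n < 1 + η :=
    hc.eventually (gt_mem_nhds (by simpa using hη))
  obtain ⟨d, hd, hball⟩ := Metric.eventually_nhds_iff.1 h1
  refine ⟨min (d / 2) 1, by positivity, min_le_right _ _, (hball ?_).le⟩
  rw [Real.dist_eq, sub_zero, abs_of_pos (by positivity)]
  exact (min_le_left _ _).trans_lt (by linarith)

/-- The weighted quadratic form differs from the unweighted one only by the relative variation of
the weight over an element. -/
lemma weighted_form_ge {s : Finset (Euc M)} {l p ρ : Euc M → ℝ} {η : ℝ} (hη : 0 ≤ η)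
    (h0 : ∀ a ∈ s, 0 ≤ l a) (h1 : ∑ a ∈ s, l a = 1) (hρ : ∀ a ∈ s, 0 < ρ a)
    (hvar : ∀ a ∈ s, ∀ b ∈ s, ρ a ≤ (1 + η) * ρ b) :
    (∑ a ∈ s, l a * (ρ a * p a)) ^ 2 - η * ∑ a ∈ s, (ρ a * p a) ^ 2 ≤
      (∑ a ∈ s, l a * p a) * ∑ a ∈ s, l a * (ρ a ^ 2 * p a) := by
  have habs : ∀ a ∈ s, ∀ b ∈ s, l a * (ρ a * p a) * (l b * (ρ b * p b)) -
      η * (l a * |ρ a * p a| * (l b * |ρ b * p b|)) ≤ l a * p a * (l b * (ρ b ^ 2 * p b)) := by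
    intro a ha b hb
    have hab : |ρ a - ρ b| ≤ η * ρ a := by
      rw [abs_le]
      constructor
      · have := hvar b hb a ha
        linarith
      · have h2 := hvar a ha b hb
        have h3 := hρ a ha
        have h4 := hρ b hb
        rcases le_total (ρ a) (ρ b) with h5 | h5
        · have : 0 ≤ η * ρ a := by positivity
          linarith
        · have : η * ρ b ≤ η * ρ a := mul_le_mul_of_nonneg_left h5 hη
          linarith
    have h2 : l a * (ρ a * p a) * (l b * (ρ b * p b)) - l a * p a * (l b * (ρ b ^ 2 * p b)) =
        l a * l b * ((ρ a - ρ b) * (p a * (ρ b * p b))) := by ring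
    have h3 : (ρ a - ρ b) * (p a * (ρ b * p b)) ≤ η * (|ρ a * p a| * |ρ b * p b|) := by
      refine (le_abs_self _).trans ?_
      rw [abs_mul, abs_mul, abs_mul (ρ a), abs_of_pos (hρ a ha)]
      have h4 := mul_le_mul_of_nonneg_right hab
        (mul_nonneg (abs_nonneg (p a)) (abs_nonneg (ρ b * p b)))
      linarith
    have h4 := mul_le_mul_of_nonneg_left h3 (mul_nonneg (h0 a ha) (h0 b hb))
    linarith
  have h2 : ∑ a ∈ s, ∑ b ∈ s, (l a * (ρ a * p a) * (l b * (ρ b * p b)) -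
      η * (l a * |ρ a * p a| * (l b * |ρ b * p b|))) ≤
      ∑ a ∈ s, ∑ b ∈ s, l a * p a * (l b * (ρ b ^ 2 * p b)) :=
    Finset.sum_le_sum fun a ha => Finset.sum_le_sum fun b hb => habs a ha b hb
  simp only [Finset.sum_sub_distrib, ← Finset.mul_sum, ← Finset.sum_mul] at h2
  have h3 := sq_sum_weights_le (z := fun a => |ρ a * p a|) h0 h1
  simp only [sq_abs] at h3
  have h4 := mul_le_mul_of_nonneg_left h3 hη
  rw [sq]
  rw [sq] at h4
  linarith

/-- The squared weights at the vertices sum up to a quantity of the order of the volume of one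
element. -/
lemma sum_volume_mul_decay_sq_le (hΩ : IsPolyhedralLipschitzDomain Ω) (hM : 0 < M)
    (h0 : 0 < T.meshSize) {ε : ℝ} (hε : 0 < ε) (hε1 : ε ≤ 1) (a : Euc M) :
    ∑ s ∈ T.cellFinset, volume.real (hull s) * ∑ b ∈ s, decay (ε / T.meshSize) a b ^ 2 ≤
      (M + 1) * 4 ^ M * decayConst M * (T.meshSize / ε) ^ M := by
  set δ := ε / T.meshSize with hδ
  have hδ0 : 0 < δ := div_pos hε h0
  have hδh : δ * T.meshSize ≤ ε := by rw [hδ, div_mul_cancel₀ _ h0.ne']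
  have hi := integrable_decay_sq hM hδ0 a
  have hcell : ∀ s ∈ T.cellFinset, volume.real (hull s) * ∑ b ∈ s, decay δ a b ^ 2 ≤
      (M + 1) * 4 ^ M * ∫ x in hull s, decay δ a x ^ 2 := by
    intro s hs
    have hs' := T.mem_cellFinset.1 hs
    have hb : ∀ b ∈ s, volume.real (hull s) * decay δ a b ^ 2 ≤
        4 ^ M * ∫ x in hull s, decay δ a x ^ 2 := by
      intro b hb
      rw [← integral_const_mul, ← smul_eq_mul, ← setIntegral_const]
      refine setIntegral_mono_on (integrableOn_const (Triangulation.volume_hull_ne_top s))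
        (hi.const_mul _).integrableOn (Triangulation.measurableSet_hull s) fun x hx => ?_
      have h1 := decay_le hδ0.le hδh a
        (T.dist_le_meshSize hs' (subset_convexHull ℝ (s : Set (Euc M)) hb) hx)
      have h2 : decay δ a b ≤ 2 ^ M * decay δ a x := h1.trans
        (mul_le_mul_of_nonneg_right (pow_le_pow_left₀ (by positivity) (by linarith) M)
          (decay_pos hδ0.le a x).le)
      calc decay δ a b ^ 2 ≤ (2 ^ M * decay δ a x) ^ 2 :=
            pow_le_pow_left₀ (decay_pos hδ0.le a b).le h2 2
        _ = 4 ^ M * decay δ a x ^ 2 := by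
            rw [mul_pow, ← pow_mul, mul_comm M, pow_mul]
            norm_num
    calc volume.real (hull s) * ∑ b ∈ s, decay δ a b ^ 2
        = ∑ b ∈ s, volume.real (hull s) * decay δ a b ^ 2 := Finset.mul_sum _ _ _
      _ ≤ ∑ _b ∈ s, 4 ^ M * ∫ x in hull s, decay δ a x ^ 2 := Finset.sum_le_sum hb
      _ = _ := by
          rw [Finset.sum_const, hs'.2, nsmul_eq_mul]
          push_cast
          ring
  calc _ ≤ ∑ s ∈ T.cellFinset, (M + 1) * 4 ^ M * ∫ x in hull s, decay δ a x ^ 2 :=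
        Finset.sum_le_sum hcell
    _ = (M + 1) * 4 ^ M * ∫ x in Ω, decay δ a x ^ 2 := by
        rw [← Finset.mul_sum, ← T.integral_eq_sum hΩ hi.integrableOn]
    _ ≤ (M + 1) * 4 ^ M * ∫ x, decay δ a x ^ 2 := by
        refine mul_le_mul_of_nonneg_left ?_ (by positivity)
        exact setIntegral_le_integral hi (ae_of_all _ fun x => sq_nonneg _)
    _ = _ := by
        rw [integral_decay_sq hδ0, hδ, ← inv_pow, inv_div]
        ring

lemma ae_abs_le_linfNorm {f : Euc M → ℝ} (hf : MemLp f ⊤ (volume.restrict Ω)) :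
    ∀ᵐ x ∂volume.restrict Ω, |f x| ≤ linfNorm Ω f := by
  have h := ae_le_eLpNormEssSup (f := f) (μ := volume.restrict Ω)
  filter_upwards [h] with x hx
  rw [← eLpNorm_exponent_top] at hx
  have := ENNReal.toReal_mono hf.eLpNorm_ne_top hx
  simpa [linfNorm] using this

/-- The `L²` projection is stable in the maximum norm on quasi-uniform meshes: testing with the
nodal values multiplied by a weight that decays away from a node shows that the influence of the
data on the value at this node decays, because the weight varies slowly on the scale of the mesh. -/
lemma exists_l2_projection_sup_bound (hΩ : IsPolyhedralLipschitzDomain Ω) (hM : 0 < M) {κ : ℝ}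
    (hκ : 0 < κ) :
    ∃ C : ℝ, 0 ≤ C ∧ ∀ T : Triangulation Ω, T.IsRegular κ → ∀ f : Euc M → ℝ,
      MemLp f 2 (volume.restrict Ω) → MemLp f ⊤ (volume.restrict Ω) → ∀ w ∈ P1 T ℝ,
      (∀ χ ∈ P1 T ℝ, ∫ x in Ω, zeroExt w x * zeroExt χ x = ∫ x in Ω, f x * zeroExt χ x) →
      ∀ a ∈ T.nodes, |zeroExt w a| ≤ C * linfNorm Ω f := by
  set m := massConst M with hm
  have hm0 : 0 < m := massConst_pos
  set η := 1 / (2 * m) with hη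
  have hη0 : 0 < η := by positivity
  obtain ⟨ε, hε, hε1, hεη⟩ := exists_one_add_pow_le M hη0
  set C₂ := 4 * m ^ 2 * ((M + 1) * 4 ^ M * decayConst M) * (κ / ε) ^ M / unitVol M with hC₂
  have hu := unitVol_pos (M := M)
  have hC₂0 : 0 ≤ C₂ := by
    have := decayConst_nonneg (M := M)
    positivity
  refine ⟨Real.sqrt C₂, Real.sqrt_nonneg _, fun T hT f hf hf' w hw hproj a ha => ?_⟩
  set h := T.meshSize with hh
  have h0 : 0 < h := T.meshSize_pos hΩ hM
  set N := linfNorm Ω f with hN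
  have hN0 : 0 ≤ N := ENNReal.toReal_nonneg
  set δ := ε / h with hδ
  have hδ0 : 0 < δ := div_pos hε h0
  have hδh : δ * h ≤ ε := by rw [hδ, div_mul_cancel₀ _ h0.ne']
  set ρ := decay δ a with hρ
  have hρ0 : ∀ x, 0 < ρ x := decay_pos hδ0.le a
  set p := zeroExt w with hp
  obtain ⟨χ, hχ, hχn⟩ := exists_mem_P1_eq_on_nodes T (fun b => ρ b ^ 2 * p b)
  obtain ⟨y, hy, hyn⟩ := exists_mem_P1_eq_on_nodes T (fun b => ρ b * p b)
  set V := ∑ s ∈ T.cellFinset, volume.real (hull s) * ∑ b ∈ s, (ρ b * p b) ^ 2 with hV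
  set W := ∑ s ∈ T.cellFinset, volume.real (hull s) * ∑ b ∈ s, ρ b ^ 2 with hW
  have hiwχ := integrable_mul_zeroExt hΩ (memLp_zeroExt hΩ w 2) χ
  have hifχ := integrable_mul_zeroExt hΩ hf χ
  have hiy := (memLp_zeroExt hΩ y 2).integrable_sq
  have hVy : V ≤ m * ∫ x in Ω, zeroExt y x ^ 2 := by
    refine le_trans (le_of_eq ?_) (sum_volume_mul_sq_le hΩ hy)
    refine Finset.sum_congr rfl fun s hs => ?_
    congr 1
    exact Finset.sum_congr rfl fun b hb => by
      rw [hyn b (T.mem_nodes_of_mem (T.mem_cellFinset.1 hs) hb)]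
  have hlow : (∫ x in Ω, zeroExt y x ^ 2) - η * V ≤ ∫ x in Ω, zeroExt w x * zeroExt χ x := by
    rw [T.integral_eq_sum hΩ hiwχ, T.integral_eq_sum hΩ hiy, hV, Finset.mul_sum,
      ← Finset.sum_sub_distrib]
    refine Finset.sum_le_sum fun s hs => ?_
    have hs' := T.mem_cellFinset.1 hs
    have hic : IntegrableOn (fun _ : Euc M => η * ∑ b ∈ s, (ρ b * p b) ^ 2) (hull s) :=
      integrableOn_const (Triangulation.volume_hull_ne_top s)
    have e1 : η * (volume.real (hull s) * ∑ b ∈ s, (ρ b * p b) ^ 2) =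
        ∫ _ in hull s, η * ∑ b ∈ s, (ρ b * p b) ^ 2 := by
      rw [setIntegral_const, smul_eq_mul]
      ring
    rw [e1, ← integral_sub (T.integrableOn_hull hΩ hiy hs') hic]
    refine setIntegral_mono_on ((T.integrableOn_hull hΩ hiy hs').sub hic)
      (T.integrableOn_hull hΩ hiwχ hs') (Triangulation.measurableSet_hull s) fun x hx => ?_
    obtain ⟨l, hl0, hl1, hl⟩ := exists_weights hs' hx
    have hvar : ∀ b ∈ s, ∀ c ∈ s, ρ b ≤ (1 + η) * ρ c := fun b hb c hc =>
      (decay_le hδ0.le hδh a (T.dist_le_meshSize hs' (subset_convexHull ℝ _ hb)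
        (subset_convexHull ℝ _ hc))).trans (mul_le_mul_of_nonneg_right hεη (hρ0 c).le)
    have h1 := weighted_form_ge (p := p) hη0.le hl0 hl1 (fun b _ => hρ0 b) hvar
    rw [hl w hw, hl χ hχ, hl y hy]
    have e2 : ∑ b ∈ s, l b * zeroExt χ b = ∑ b ∈ s, l b * (ρ b ^ 2 * p b) :=
      Finset.sum_congr rfl fun b hb => by rw [hχn b (T.mem_nodes_of_mem hs' hb)]
    have e3 : ∑ b ∈ s, l b * zeroExt y b = ∑ b ∈ s, l b * (ρ b * p b) :=
      Finset.sum_congr rfl fun b hb => by rw [hyn b (T.mem_nodes_of_mem hs' hb)]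
    rw [e2, e3]
    exact h1
  -- Young's inequality with weights that let the quadratic part be absorbed
  have hup : ∫ x in Ω, f x * zeroExt χ x ≤ 1 / (4 * m) * V + m * N ^ 2 * W := by
    rw [T.integral_eq_sum hΩ hifχ, hV, hW, Finset.mul_sum, Finset.mul_sum,
      ← Finset.sum_add_distrib]
    refine Finset.sum_le_sum fun s hs => ?_
    have hs' := T.mem_cellFinset.1 hs
    set c := 1 / (4 * m) * ∑ b ∈ s, (ρ b * p b) ^ 2 + m * N ^ 2 * ∑ b ∈ s, ρ b ^ 2 with hc
    have hic : IntegrableOn (fun _ : Euc M => c) (hull s) :=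
      integrableOn_const (Triangulation.volume_hull_ne_top s)
    have e1 : 1 / (4 * m) * (volume.real (hull s) * ∑ b ∈ s, (ρ b * p b) ^ 2) +
        m * N ^ 2 * (volume.real (hull s) * ∑ b ∈ s, ρ b ^ 2) = ∫ _ in hull s, c := by
      rw [setIntegral_const, smul_eq_mul, hc]
      ring
    rw [e1]
    refine integral_mono_ae (T.integrableOn_hull hΩ hifχ hs') hic ?_
    have hae : ∀ᵐ x ∂volume.restrict (closure Ω), |f x| ≤ N := by
      rw [hΩ.restrict_closure]
      exact ae_abs_le_linfNorm hf'
    filter_upwards [ae_restrict_of_ae_restrict_of_subset (T.hull_subset hs') hae,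
      ae_restrict_mem (Triangulation.measurableSet_hull s)] with x hfx hx
    obtain ⟨l, hl0, hl1, hl⟩ := exists_weights hs' hx
    have hle1 : ∀ b ∈ s, l b ≤ 1 := fun b hb => by
      rw [← hl1]
      exact Finset.single_le_sum hl0 hb
    rw [hl χ hχ, Finset.mul_sum, hc, Finset.mul_sum, Finset.mul_sum, ← Finset.sum_add_distrib]
    refine Finset.sum_le_sum fun b hb => ?_
    rw [hχn b (T.mem_nodes_of_mem hs' hb)]
    have h1 : f x * (l b * (ρ b ^ 2 * p b)) ≤ N * (ρ b * |ρ b * p b|) := by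
      refine (le_abs_self _).trans ?_
      rw [abs_mul, abs_mul, abs_of_nonneg (hl0 b hb), sq, mul_assoc, abs_mul (ρ b),
        abs_of_pos (hρ0 b)]
      have h2 : 0 ≤ ρ b * |ρ b * p b| := mul_nonneg (hρ0 b).le (abs_nonneg _)
      exact mul_le_mul hfx (mul_le_of_le_one_left h2 (hle1 b hb)) (mul_nonneg (hl0 b hb) h2) hN0
    refine h1.trans ?_
    rw [← sq_abs (ρ b * p b)]
    set z := |ρ b * p b|
    have h3 : 0 ≤ 1 / (4 * m) * (z - 2 * m * (N * ρ b)) ^ 2 := by positivity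
    have h4 : 1 / (4 * m) * (z - 2 * m * (N * ρ b)) ^ 2 =
        1 / (4 * m) * z ^ 2 + m * N ^ 2 * ρ b ^ 2 - N * (ρ b * z) := by
      field_simp
      ring
    linarith
  have hVle : V ≤ 4 * m ^ 2 * (N ^ 2 * W) := by
    have h1 := hproj χ hχ
    have h2 : V / m ≤ ∫ x in Ω, zeroExt y x ^ 2 := by
      rw [div_le_iff₀' hm0]; exact hVy
    have h3 : V / m - η * V - 1 / (4 * m) * V ≤ m * N ^ 2 * W := by linarith
    have h4 : V / m - η * V - 1 / (4 * m) * V = V / (4 * m) := by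
      rw [hη]
      field_simp
      ring
    rw [h4, div_le_iff₀ (by positivity)] at h3
    linarith
  have hWle : W ≤ (M + 1) * 4 ^ M * decayConst M * (h / ε) ^ M :=
    sum_volume_mul_decay_sq_le hΩ hM h0 hε hε1 a
  have hVge : unitVol M * (h / κ) ^ M * p a ^ 2 ≤ V := by
    obtain ⟨s, hs, has⟩ := T.exists_cell_of_mem_nodes ha
    have h1 : (ρ a * p a) ^ 2 ≤ ∑ b ∈ s, (ρ b * p b) ^ 2 :=
      Finset.single_le_sum (f := fun b => (ρ b * p b) ^ 2) (fun b _ => sq_nonneg _) has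
    have h2 : volume.real (hull s) * ∑ b ∈ s, (ρ b * p b) ^ 2 ≤ V :=
      Finset.single_le_sum (f := fun s => volume.real (hull s) * ∑ b ∈ s, (ρ b * p b) ^ 2)
        (fun s _ => mul_nonneg measureReal_nonneg (Finset.sum_nonneg fun b _ => sq_nonneg _))
        (T.mem_cellFinset.2 hs)
    rw [hρ, decay_self, one_mul] at h1
    exact (mul_le_mul (hT.le_volume hs h0) h1 (sq_nonneg _) measureReal_nonneg).trans h2
  have hfinal : p a ^ 2 ≤ C₂ * N ^ 2 := by
    have hc : 0 < unitVol M * (h / κ) ^ M := by positivity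
    have h1 : unitVol M * (h / κ) ^ M * p a ^ 2 ≤
        4 * m ^ 2 * (N ^ 2 * ((M + 1) * 4 ^ M * decayConst M * (h / ε) ^ M)) :=
      (hVge.trans hVle).trans (by gcongr)
    have h2 : 4 * m ^ 2 * (N ^ 2 * ((M + 1) * 4 ^ M * decayConst M * (h / ε) ^ M)) =
        unitVol M * (h / κ) ^ M * (C₂ * N ^ 2) := by
      rw [hC₂, div_pow, div_pow, div_pow]
      field_simp
    rw [h2] at h1
    exact le_of_mul_le_mul_left h1 hc
  calc |p a| = Real.sqrt (p a ^ 2) := (Real.sqrt_sq_eq_abs _).symm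
    _ ≤ Real.sqrt (C₂ * N ^ 2) := Real.sqrt_le_sqrt hfinal
    _ = Real.sqrt C₂ * N := by rw [Real.sqrt_mul hC₂0, Real.sqrt_sq hN0]

end

section

variable {M : ℕ} {Ω : Set (Euc M)} {F : Type*} [NormedAddCommGroup F]

/-! ### The maximum norm of a finite element function -/

/-- A continuous function on the closure of the domain is bounded by its essential supremum
everywhere. -/
lemma norm_zeroExt_le_linfNorm (hΩ : IsPolyhedralLipschitzDomain Ω) (v : C(closure Ω, F))
    {x : Euc M} (hx : x ∈ closure Ω) : ‖zeroExt v x‖ ≤ linfNorm Ω (zeroExt v) := by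
  have hae : ∀ᵐ y ∂volume.restrict Ω, ‖zeroExt v y‖ ≤ linfNorm Ω (zeroExt v) := by
    filter_upwards [ae_le_eLpNormEssSup (f := zeroExt v) (μ := volume.restrict Ω)] with y hy
    rw [← eLpNorm_exponent_top] at hy
    simpa [linfNorm] using ENNReal.toReal_mono (memLp_zeroExt hΩ v ⊤).eLpNorm_ne_top hy
  by_contra! hlt
  have hcont := (continuousOn_zeroExt v).norm x hx
  have hev : ∀ᶠ y in nhdsWithin x (closure Ω), linfNorm Ω (zeroExt v) < ‖zeroExt v y‖ :=
    hcont.eventually (lt_mem_nhds hlt)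
  obtain ⟨U, hU, hxU, hsub⟩ := mem_nhdsWithin.1 hev
  have hne : (U ∩ Ω).Nonempty := mem_closure_iff.1 hx U hU hxU
  have hpos : 0 < volume (U ∩ Ω) := (hU.inter hΩ.isOpen).measure_pos volume hne
  rw [ae_restrict_iff' hΩ.isOpen.measurableSet, ae_iff] at hae
  refine hpos.ne' (measure_mono_null (fun y hy => ?_) hae)
  simp only [mem_ofPred_eq, Classical.not_imp, not_le]
  exact ⟨hy.2, hsub ⟨hy.1, subset_closure hy.2⟩⟩

variable [NormedSpace ℝ F] {T : Triangulation Ω}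

lemma norm_zeroExt_le_of_nodes {v : C(closure Ω, F)} (hv : v ∈ P1 T F) {W : ℝ}
    (hW : ∀ a ∈ T.nodes, ‖zeroExt v a‖ ≤ W) {x : Euc M} (hx : x ∈ closure Ω) :
    ‖zeroExt v x‖ ≤ W := by
  rw [T.closure_eq_iUnion] at hx
  obtain ⟨s, hs, hxs⟩ := mem_iUnion₂.1 hx
  have hs' := T.mem_cellFinset.1 hs
  exact norm_zeroExt_le_of_hull hv hs' (fun a ha => hW a (T.mem_nodes_of_mem hs' ha)) hxs

lemma linfNorm_zeroExt_le (hΩ : IsPolyhedralLipschitzDomain Ω) {v : C(closure Ω, F)}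
    (hv : v ∈ P1 T F) {W : ℝ} (hW0 : 0 ≤ W) (hW : ∀ a ∈ T.nodes, ‖zeroExt v a‖ ≤ W) :
    linfNorm Ω (zeroExt v) ≤ W := by
  refine ENNReal.toReal_le_of_le_ofReal hW0 ?_
  rw [eLpNorm_exponent_top]
  refine eLpNormEssSup_le_of_ae_bound ?_
  filter_upwards [ae_restrict_mem hΩ.isOpen.measurableSet] with x hx
  exact norm_zeroExt_le_of_nodes hv hW (subset_closure hx)

/-! ### The test field -/

lemma zeroExt_nodalInterp_dot (u v : C(closure Ω, Euc M)) {a : Euc M} (ha : a ∈ T.nodes) :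
    zeroExt (nodalInterp T (dot u v)) a = inner ℝ (zeroExt u a) (zeroExt v a) := by
  have hac := T.nodes_subset ha
  rw [zeroExt_nodalInterp _ ha, zeroExt_of_mem _ hac, zeroExt_of_mem _ hac, zeroExt_of_mem _ hac]
  rfl

/-- The product rule, for differences of nodal values. -/
lemma jumpEnergy_smul_le {w : Euc M → ℝ} {u v : Euc M → F} {W : ℝ}
    (hW : ∀ a ∈ T.nodes, |w a| ≤ W) (hu : ∀ a ∈ T.nodes, ‖u a‖ = 1)
    (hv : ∀ a ∈ T.nodes, v a = w a • u a) :
    jumpEnergy T v ≤ 2 * jumpEnergy T w + 2 * W ^ 2 * jumpEnergy T u := by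
  rw [jumpEnergy, jumpEnergy, jumpEnergy, Finset.mul_sum, Finset.mul_sum, ← Finset.sum_add_distrib]
  refine Finset.sum_le_sum fun s hs => ?_
  have hs' := T.mem_cellFinset.1 hs
  have h : ∑ a ∈ s, ∑ b ∈ s, ‖v a - v b‖ ^ 2 ≤ ∑ a ∈ s, ∑ b ∈ s,
      (2 * ‖w a - w b‖ ^ 2 + 2 * W ^ 2 * ‖u a - u b‖ ^ 2) := by
    refine Finset.sum_le_sum fun a ha => Finset.sum_le_sum fun b hb => ?_
    have han := T.mem_nodes_of_mem hs' ha
    have hbn := T.mem_nodes_of_mem hs' hb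
    have e : v a - v b = (w a - w b) • u a + w b • (u a - u b) := by
      rw [hv a han, hv b hbn, sub_smul, smul_sub]
      abel
    have h1 : ‖v a - v b‖ ≤ ‖w a - w b‖ + W * ‖u a - u b‖ := by
      rw [e]
      refine (norm_add_le _ _).trans ?_
      rw [norm_smul, norm_smul, hu a han, mul_one]
      gcongr
      exact hW b hbn
    have h2 := pow_le_pow_left₀ (norm_nonneg _) h1 2
    nlinarith [sq_nonneg (‖w a - w b‖ - W * ‖u a - u b‖)]
  refine (mul_le_mul_of_nonneg_left h measureReal_nonneg).trans (le_of_eq ?_)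
  simp only [Finset.sum_add_distrib, ← Finset.mul_sum]
  ring

lemma le_one_of_h1LinfNorm_le_one {f : Euc M → ℝ} {G : Euc M → Euc M}
    (h : h1LinfNorm Ω f G ≤ 1) :
    l2Norm Ω f ^ 2 + l2Norm Ω G ^ 2 ≤ 1 ∧ linfNorm Ω f ≤ 1 := by
  have h1 : 0 ≤ linfNorm Ω f := ENNReal.toReal_nonneg
  have h2 := Real.sqrt_nonneg (l2Norm Ω f ^ 2 + l2Norm Ω G ^ 2)
  unfold h1LinfNorm at h
  refine ⟨?_, by linarith⟩
  rw [← Real.sqrt_le_one]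
  linarith

/-- Given data in the unit ball of `H¹ ∩ L^∞`, the nodal interpolant of the product of its `L²`
projection with `u` is a test field with controlled norm; since `u` has unit length at the nodes,
its discrete scalar product with `u` is the projection itself. -/
lemma exists_test_field (hΩ : IsPolyhedralLipschitzDomain Ω) (hM : 0 < M) {κ : ℝ} (hκ : 0 < κ) :
    ∃ C : ℝ, 0 < C ∧ ∀ T : Triangulation Ω, T.IsRegular κ → ∀ u ∈ P1 T (Euc M),
      (∀ a ∈ T.nodes, ‖zeroExt u a‖ = 1) → ∀ (f : Euc M → ℝ) (G : Euc M → Euc M),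
      MemH1Linf Ω f G → h1LinfNorm Ω f G ≤ 1 → ∃ v ∈ P1 T (Euc M),
        gradNorm v + linfNorm Ω (zeroExt v) ≤ C * (1 + gradNorm u) ∧
        ∀ q ∈ P1 T ℝ, l2Inner Ω (zeroExt q) (zeroExt (nodalInterp T (dot u v))) =
          l2Inner Ω (zeroExt q) f := by
  obtain ⟨C₁, hC₁, hav⟩ := exists_nodal_average_bound hΩ hM hκ
  obtain ⟨C₂, hC₂, hsup⟩ := exists_l2_projection_sup_bound hΩ hM hκ
  set A := M * κ ^ 2 * (2 * (6 * (M + 1) * (massConst M + 2) * C₁)) with hA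
  set B := M * κ ^ 2 * (2 * C₂ ^ 2 * (M + 1) ^ 2) with hB
  have hm := massConst_pos (M := M)
  have hA0 : 0 ≤ A := by positivity
  have hB0 : 0 ≤ B := by positivity
  refine ⟨A + B + 1 + C₂, by positivity, fun T hT u hu hu1 f G hfG hfG1 => ?_⟩
  obtain ⟨hH1, hN1⟩ := le_one_of_h1LinfNorm_le_one hfG1
  set h := T.meshSize with hh
  have h0 : 0 < h := T.meshSize_pos hΩ hM
  obtain ⟨w, hw, hproj⟩ := exists_l2_projection hΩ hT h0 hfG.memLp_two
  obtain ⟨J, hJ⟩ := hav T hT f G hfG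
  have hW : ∀ a ∈ T.nodes, |zeroExt w a| ≤ C₂ := fun a ha =>
    (hsup T hT f hfG.memLp_two hfG.memLp_top w hw hproj a ha).trans
      (mul_le_of_le_one_right hC₂ hN1)
  have hEw : jumpEnergy T (zeroExt w) ≤ 6 * (M + 1) * (massConst M + 2) * (C₁ * h ^ 2) := by
    refine (jumpEnergy_l2_projection_le hΩ hfG.memLp_two hw hproj J).trans ?_
    refine mul_le_mul_of_nonneg_left (hJ.trans ?_) (by positivity)
    exact mul_le_of_le_one_right (by positivity) hH1
  set g : C(closure Ω, Euc M) := ⟨fun x => w x • u x, w.continuous.smul u.continuous⟩ with hg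
  set v := nodalInterp T g with hv
  have hvP : v ∈ P1 T (Euc M) := nodalInterp_mem T g
  have hvn : ∀ a ∈ T.nodes, zeroExt v a = zeroExt w a • zeroExt u a := by
    intro a ha
    have hac := T.nodes_subset ha
    rw [hv, zeroExt_nodalInterp _ ha, zeroExt_of_mem _ hac, zeroExt_of_mem _ hac,
      zeroExt_of_mem _ hac]
    rfl
  have hdot : nodalInterp T (dot u v) = w := by
    refine P1_ext T (nodalInterp_mem T _) hw fun a ha => ?_
    rw [← zeroExt_coe, ← zeroExt_coe, zeroExt_nodalInterp_dot u v ha, hvn a ha, inner_smul_right,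
      real_inner_self_eq_norm_sq, hu1 a ha]
    ring
  have hgrad : gradNorm v ^ 2 ≤ A + B * gradNorm u ^ 2 := by
    have h1 := gradNorm_sq_le hΩ hT h0 hvP
    have h2 := jumpEnergy_smul_le hW hu1 hvn
    have h3 := jumpEnergy_le hΩ hu
    have h4 : jumpEnergy T (zeroExt v) ≤ 2 * (6 * (M + 1) * (massConst M + 2) * (C₁ * h ^ 2)) +
        2 * C₂ ^ 2 * (((M + 1) * h) ^ 2 * gradNorm u ^ 2) :=
      h2.trans (by gcongr)
    refine (h1.trans (mul_le_mul_of_nonneg_left h4 (by positivity))).trans (le_of_eq ?_)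
    rw [hA, hB, ← hh]
    field_simp
  have hu0 := gradNorm_nonneg u
  have hgv : gradNorm v ≤ (A + B + 1) * (1 + gradNorm u) := by
    refine le_of_sq_le_sq (hgrad.trans ?_) (by positivity)
    have h1 : A + B * gradNorm u ^ 2 ≤ (A + B + 1) * (1 + gradNorm u) ^ 2 := by
      nlinarith [mul_nonneg hA0 hu0, mul_nonneg hB0 hu0, mul_nonneg hA0 (sq_nonneg (gradNorm u))]
    rw [mul_pow]
    refine h1.trans (mul_le_mul_of_nonneg_right ?_ (sq_nonneg _))
    nlinarith
  have hlv : linfNorm Ω (zeroExt v) ≤ C₂ := by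
    refine linfNorm_zeroExt_le hΩ hvP hC₂ fun a ha => ?_
    rw [hvn a ha, norm_smul, hu1 a ha, mul_one]
    exact hW a ha
  refine ⟨v, hvP, ?_, fun q hq => ?_⟩
  · have : 0 ≤ C₂ * gradNorm u := mul_nonneg hC₂ hu0
    nlinarith
  · rw [hdot, l2Inner, l2Inner]
    have := hproj q hq
    simpa only [mul_comm] using this

/-! ### The dual norm -/

lemma l2Norm_smul (c : ℝ) (f : Euc M → F) : l2Norm Ω (c • f) = |c| * l2Norm Ω f := by
  simp [l2Norm, eLpNorm_const_smul, ENNReal.toReal_mul]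

lemma h1LinfNorm_smul {c : ℝ} (hc : 0 ≤ c) (f : Euc M → ℝ) (G : Euc M → Euc M) :
    h1LinfNorm Ω (c • f) (c • G) = c * h1LinfNorm Ω f G := by
  have h1 : linfNorm Ω (c • f) = c * linfNorm Ω f := by
    rw [linfNorm, linfNorm, eLpNorm_const_smul, ENNReal.toReal_mul]
    simp [abs_of_nonneg hc]
  rw [h1LinfNorm, h1LinfNorm, l2Norm_smul, l2Norm_smul, h1, abs_of_nonneg hc, mul_pow, mul_pow,
    ← mul_add, Real.sqrt_mul (sq_nonneg c), Real.sqrt_sq hc]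
  ring

lemma MemH1Linf.const_smul {f : Euc M → ℝ} {G : Euc M → Euc M} (h : MemH1Linf Ω f G) (c : ℝ) :
    MemH1Linf Ω (c • f) (c • G) where
  memLp_two := h.memLp_two.const_smul c
  memLp_top := h.memLp_top.const_smul c
  memLp_grad := h.memLp_grad.const_smul c
  isWeakGradient := by
    intro φ h1 h2 h3 e
    have := h.isWeakGradient φ h1 h2 h3 e
    simp only [Pi.smul_apply, smul_eq_mul, mul_assoc, inner_smul_left, integral_const_mul]
    rw [this]
    simp

/-- A test function belongs to `H¹ ∩ L^∞`, with its classical gradient. -/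
lemma memH1Linf_of_contDiff {φ : Euc M → ℝ}
    (hφ : ContDiff ℝ ∞ φ) (hc : HasCompactSupport φ) (hs : tsupport φ ⊆ Ω) :
    MemH1Linf Ω φ (gradient φ) := by
  have hG : Continuous (gradient φ) :=
    (InnerProductSpace.toDual ℝ (Euc M)).symm.continuous.comp (hφ.continuous_fderiv (by simp))
  have hGc : HasCompactSupport (gradient φ) := by
    refine (hc.fderiv (𝕜 := ℝ)).comp_left (g := (InnerProductSpace.toDual ℝ (Euc M)).symm) ?_
    simp
  have hfd : ∀ x e, inner ℝ (gradient φ x) e = fderiv ℝ φ x e := fun x e => by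
    rw [gradient, InnerProductSpace.toDual_symm_apply]
  refine ⟨(hφ.continuous.memLp_of_hasCompactSupport hc).restrict Ω,
    (hφ.continuous.memLp_of_hasCompactSupport hc).restrict Ω,
    (hG.memLp_of_hasCompactSupport hGc).restrict Ω, ?_⟩
  intro ψ hψ hψc _ e
  simp only [hfd]
  have hψd : Continuous fun x => fderiv ℝ ψ x e :=
    (hψ.continuous_fderiv (by simp)).clm_apply continuous_const
  have hφd : Continuous fun x => fderiv ℝ φ x e :=
    (hφ.continuous_fderiv (by simp)).clm_apply continuous_const
  rw [setIntegral_eq_integral_of_forall_compl_eq_zero,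
    setIntegral_eq_integral_of_forall_compl_eq_zero]
  · refine integral_mul_fderiv_eq_neg_fderiv_mul_of_integrable ?_ ?_ ?_
      (fun x _ => hφ.differentiable (by simp) x) (fun x _ => hψ.differentiable (by simp) x)
    · exact (hφd.mul hψ.continuous).integrable_of_hasCompactSupport hψc.mul_left
    · exact (hφ.continuous.mul hψd).integrable_of_hasCompactSupport hc.mul_right
    · exact (hφ.continuous.mul hψ.continuous).integrable_of_hasCompactSupport hc.mul_right
  · intro x hx
    have hx' : x ∉ tsupport φ := fun h => hx (hs h)
    have : fderiv ℝ φ x = 0 := by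
      by_contra hne
      exact hx' (support_fderiv_subset ℝ hne)
    simp [this]
  · intro x hx
    have : φ x = 0 := image_eq_zero_of_notMem_tsupport fun h => hx (hs h)
    simp [this]

lemma abs_l2Inner_le (hΩ : IsPolyhedralLipschitzDomain Ω) (q : C(closure Ω, ℝ)) {f : Euc M → ℝ}
    {N : ℝ} (hf : ∀ᵐ x ∂volume.restrict Ω, |f x| ≤ N) :
    |l2Inner Ω (zeroExt q) f| ≤ (∫ x in Ω, |zeroExt q x|) * N := by
  have hfin := hΩ.isFiniteMeasure_restrict
  have hq : Integrable (zeroExt q) (volume.restrict Ω) :=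
    (memLp_zeroExt hΩ q 1).integrable le_rfl
  rw [← integral_mul_const, l2Inner, ← Real.norm_eq_abs]
  refine norm_integral_le_of_norm_le (hq.abs.mul_const N) ?_
  filter_upwards [hf] with x hx
  rw [Real.norm_eq_abs, abs_mul]
  exact mul_le_mul_of_nonneg_left hx (abs_nonneg _)

lemma bddAbove_dualNorm_set (hΩ : IsPolyhedralLipschitzDomain Ω) (q : C(closure Ω, ℝ)) :
    BddAbove {r | ∃ (f : Euc M → ℝ) (G : Euc M → Euc M),
      MemH1Linf Ω f G ∧ h1LinfNorm Ω f G ≤ 1 ∧ r = |l2Inner Ω (zeroExt q) f|} := by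
  refine ⟨∫ x in Ω, |zeroExt q x|, ?_⟩
  rintro r ⟨f, G, hfG, h1, rfl⟩
  refine (abs_l2Inner_le hΩ q (ae_abs_le_linfNorm hfG.memLp_top)).trans ?_
  exact mul_le_of_le_one_right (integral_nonneg fun x => abs_nonneg _)
    (le_one_of_h1LinfNorm_le_one h1).2

/-- The dual norm is a norm on continuous functions: smooth test functions detect them. -/
lemma dualNorm_pos (hΩ : IsPolyhedralLipschitzDomain Ω) {q : C(closure Ω, ℝ)} (hq : q ≠ 0) :
    0 < dualNorm Ω (zeroExt q) := by
  by_contra! hD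
  refine hq ?_
  have hzero : ∀ φ : Euc M → ℝ, ContDiff ℝ ∞ φ → HasCompactSupport φ → tsupport φ ⊆ Ω →
      ∫ x, φ x • zeroExt q x = 0 := by
    intro φ h1 h2 h3
    have hmem := memH1Linf_of_contDiff h1 h2 h3
    have hn : 0 ≤ h1LinfNorm Ω φ (gradient φ) :=
      add_nonneg (Real.sqrt_nonneg _) ENNReal.toReal_nonneg
    set c := (1 + h1LinfNorm Ω φ (gradient φ))⁻¹ with hc
    have hc0 : 0 < c := by positivity
    have hle : |l2Inner Ω (zeroExt q) (c • φ)| ≤ dualNorm Ω (zeroExt q) := by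
      refine le_csSup (bddAbove_dualNorm_set hΩ q) ⟨c • φ, c • gradient φ, hmem.const_smul c, ?_, rfl⟩
      rw [h1LinfNorm_smul hc0.le, hc, inv_mul_le_one₀ (by positivity)]
      linarith
    have h4 : l2Inner Ω (zeroExt q) (c • φ) = 0 := abs_nonpos_iff.1 (hle.trans hD)
    have h5 : l2Inner Ω (zeroExt q) (c • φ) = c * ∫ x in Ω, φ x • zeroExt q x := by
      rw [l2Inner, ← integral_const_mul]
      congr 1
      ext x
      simp only [Pi.smul_apply, smul_eq_mul]
      ring
    rw [h5] at h4
    have h6 := (mul_eq_zero.1 h4).resolve_left hc0.ne'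
    rwa [setIntegral_eq_integral_of_forall_compl_eq_zero] at h6
    intro x hx
    have : φ x = 0 := image_eq_zero_of_notMem_tsupport fun h => hx (h3 h)
    simp [this]
  have hfin := hΩ.isFiniteMeasure_restrict
  have hqi : IntegrableOn (zeroExt q) Ω := (memLp_zeroExt hΩ q 1).integrable le_rfl
  have hae := hΩ.isOpen.ae_eq_zero_of_integral_contDiff_smul_eq_zero hqi.locallyIntegrableOn hzero
  have h0 : linfNorm Ω (zeroExt q) = 0 := by
    have h1 : zeroExt q =ᵐ[volume.restrict Ω] 0 :=
      (ae_restrict_iff' hΩ.isOpen.measurableSet).2 hae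
    rw [linfNorm, eLpNorm_congr_ae h1, eLpNorm_zero, ENNReal.toReal_zero]
  ext x
  have := norm_zeroExt_le_linfNorm hΩ q x.2
  rw [h0, zeroExt_coe] at this
  simpa using this

/-- The set of quotients in the inf-sup condition is bounded. -/
lemma bddAbove_quotients (hΩ : IsPolyhedralLipschitzDomain Ω) {u : C(closure Ω, Euc M)}
    (hu1 : ∀ a ∈ T.nodes, ‖zeroExt u a‖ = 1) {q : C(closure Ω, ℝ)} (hq : q ≠ 0) :
    BddAbove (range fun v : {v : C(closure Ω, Euc M) // v ∈ P1 T (Euc M) ∧ v ≠ 0} =>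
      l2Inner Ω (zeroExt q) (zeroExt (nodalInterp T (dot u v.1))) /
        (dualNorm Ω (zeroExt q) * (gradNorm v.1 + linfNorm Ω (zeroExt v.1)))) := by
  have hD := dualNorm_pos hΩ hq
  set I := ∫ x in Ω, |zeroExt q x| with hI
  have hI0 : 0 ≤ I := integral_nonneg fun x => abs_nonneg _
  refine ⟨I / dualNorm Ω (zeroExt q), ?_⟩
  rintro _ ⟨⟨v, hv, -⟩, rfl⟩
  simp only
  set X := gradNorm v + linfNorm Ω (zeroExt v) with hX
  have hL0 : 0 ≤ linfNorm Ω (zeroExt v) := ENNReal.toReal_nonneg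
  have hX0 : 0 ≤ X := add_nonneg (gradNorm_nonneg v) hL0
  have hnum : l2Inner Ω (zeroExt q) (zeroExt (nodalInterp T (dot u v))) ≤ I * X := by
    have hb : ∀ᵐ x ∂volume.restrict Ω, |zeroExt (nodalInterp T (dot u v)) x| ≤ X := by
      filter_upwards [ae_restrict_mem hΩ.isOpen.measurableSet] with x hx
      rw [← Real.norm_eq_abs]
      refine norm_zeroExt_le_of_nodes (nodalInterp_mem T (dot u v)) (fun a ha => ?_)
        (subset_closure hx)
      rw [zeroExt_nodalInterp_dot u v ha]
      refine (norm_inner_le_norm _ _).trans ?_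
      rw [hu1 a ha, one_mul]
      exact (norm_zeroExt_le_linfNorm hΩ v (T.nodes_subset ha)).trans
        (le_add_of_nonneg_left (gradNorm_nonneg v))
    exact (le_abs_self _).trans (abs_l2Inner_le hΩ q hb)
  rcases hX0.eq_or_lt with h | h
  · rw [← h, mul_zero, div_zero]
    positivity
  · rw [div_le_div_iff₀ (by positivity) hD]
    nlinarith

lemma nonempty_P1_ne_zero (hΩ : IsPolyhedralLipschitzDomain Ω) (T : Triangulation Ω) :
    Nonempty {q : C(closure Ω, ℝ) // q ∈ P1 T ℝ ∧ q ≠ 0} := by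
  refine ⟨⟨1, fun s _ => ⟨AffineMap.const ℝ (Euc M) (1 : ℝ), fun x _ => rfl⟩, fun h => ?_⟩⟩
  obtain ⟨x, hx⟩ := hΩ.isConnected.nonempty
  have := congrArg (fun g : C(closure Ω, ℝ) => g ⟨x, subset_closure hx⟩) h
  simp at this

lemma MemH1Linf.neg {f : Euc M → ℝ} {G : Euc M → Euc M} (h : MemH1Linf Ω f G) :
    MemH1Linf Ω (-f) (-G) := by
  simpa using h.const_smul (-1)

lemma h1LinfNorm_neg (f : Euc M → ℝ) (G : Euc M → Euc M) :
    h1LinfNorm Ω (-f) (-G) = h1LinfNorm Ω f G := by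
  simp only [h1LinfNorm, l2Norm, linfNorm, eLpNorm_neg]

/-- The dual norm is attained up to a factor `2`. -/
lemma exists_half_dualNorm_lt (hΩ : IsPolyhedralLipschitzDomain Ω) {q : C(closure Ω, ℝ)}
    (hq : q ≠ 0) : ∃ (f : Euc M → ℝ) (G : Euc M → Euc M), MemH1Linf Ω f G ∧
      h1LinfNorm Ω f G ≤ 1 ∧ dualNorm Ω (zeroExt q) / 2 < l2Inner Ω (zeroExt q) f := by
  have hD := dualNorm_pos hΩ hq
  have hne : {r | ∃ (f : Euc M → ℝ) (G : Euc M → Euc M),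
      MemH1Linf Ω f G ∧ h1LinfNorm Ω f G ≤ 1 ∧ r = |l2Inner Ω (zeroExt q) f|}.Nonempty := by
    by_contra! h
    rw [dualNorm, h, Real.sSup_empty] at hD
    exact hD.false
  obtain ⟨_, ⟨f, G, hfG, h1, rfl⟩, hlt⟩ := exists_lt_of_lt_csSup hne (half_lt_self hD)
  change dualNorm Ω (zeroExt q) / 2 < _ at hlt
  rcases abs_cases (l2Inner Ω (zeroExt q) f) with h | h
  · exact ⟨f, G, hfG, h1, by rwa [h.1] at hlt⟩
  · refine ⟨-f, -G, hfG.neg, by rwa [h1LinfNorm_neg], ?_⟩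
    have e : l2Inner Ω (zeroExt q) (-f) = - l2Inner Ω (zeroExt q) f := by
      simp [l2Inner, integral_neg]
    rwa [e, ← h.1]

end

end P1FEM

open P1FEM in
theorem mainTheorem1 {M : ℕ} (hM : M = 2 ∨ M = 3) {Ω : Set (EuclideanSpace ℝ (Fin M))}
    (hΩ : IsPolyhedralLipschitzDomain Ω) {ι : Type*} (𝒯 : ι → Triangulation Ω)
    (hreg : ShapeRegular 𝒯) (hqu : QuasiUniform 𝒯) :
    ∃ C : ℝ, 0 < C ∧ ∀ (i : ι), ∀ u ∈ P1 (𝒯 i) (EuclideanSpace ℝ (Fin M)),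
      (∀ a : closure Ω, (a : EuclideanSpace ℝ (Fin M)) ∈ (𝒯 i).nodes → ‖u a‖ = 1) →
      C * (1 / (1 + gradNorm u)) ≤
        ⨅ q : {q : C(closure Ω, ℝ) // q ∈ P1 (𝒯 i) ℝ ∧ q ≠ 0},
          ⨆ v : {v : C(closure Ω, EuclideanSpace ℝ (Fin M)) //
              v ∈ P1 (𝒯 i) (EuclideanSpace ℝ (Fin M)) ∧ v ≠ 0},
            l2Inner Ω (zeroExt q.1) (zeroExt (nodalInterp (𝒯 i) (dot u v.1))) /
              (dualNorm Ω (zeroExt q.1) * (gradNorm v.1 + linfNorm Ω (zeroExt v.1))) := by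
  have hM0 : 0 < M := by omega
  obtain ⟨κ, hκ⟩ := exists_isRegular hreg hqu
  rcases isEmpty_or_nonempty ι with hι | ⟨⟨i₀⟩⟩
  · exact ⟨1, one_pos, fun i => isEmptyElim i⟩
  obtain ⟨C, hC, htest⟩ := exists_test_field hΩ hM0 (hκ i₀).pos
  refine ⟨1 / (2 * C), by positivity, fun i u hu hu1 => ?_⟩
  have hu1' : ∀ a ∈ (𝒯 i).nodes, ‖zeroExt u a‖ = 1 := fun a ha => by
    rw [zeroExt_of_mem u ((𝒯 i).nodes_subset ha)]
    exact hu1 _ ha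
  have := nonempty_P1_ne_zero hΩ (𝒯 i)
  refine le_ciInf fun ⟨q, hq, hq0⟩ => ?_
  simp only
  have hD := dualNorm_pos hΩ hq0
  obtain ⟨f, G, hfG, hfG1, hlt⟩ := exists_half_dualNorm_lt hΩ hq0
  obtain ⟨v, hv, hvle, hvq⟩ := htest (𝒯 i) (hκ i) u hu hu1' f G hfG hfG1
  have hnum : dualNorm Ω (zeroExt q) / 2 <
      l2Inner Ω (zeroExt q) (zeroExt (nodalInterp (𝒯 i) (dot u v))) := by
    rwa [hvq q hq]
  have hv0 : v ≠ 0 := by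
    rintro rfl
    have h0 : nodalInterp (𝒯 i) (dot u 0) = 0 :=
      P1_ext (𝒯 i) (nodalInterp_mem _ _) (Submodule.zero_mem _) fun a ha => by
        rw [nodalInterp_apply _ _ _ ha]
        simp [dot]
    have hz : zeroExt (0 : C(closure Ω, ℝ)) = 0 :=
      funext fun x => by simpa using zeroExt_smul 0 (0 : C(closure Ω, ℝ)) x
    rw [h0, hz] at hnum
    simp only [l2Inner, Pi.zero_apply, mul_zero, integral_zero] at hnum
    linarith
  refine le_trans ?_ (le_ciSup (bddAbove_quotients hΩ hu1' hq0) ⟨v, hv, hv0⟩)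
  simp only
  set X := gradNorm v + linfNorm Ω (zeroExt v) with hX
  have hX0 : 0 < X := by
    obtain ⟨x, hx⟩ : ∃ x, v x ≠ 0 := by
      by_contra! h
      exact hv0 (ContinuousMap.ext h)
    have h1 := norm_zeroExt_le_linfNorm hΩ v x.2
    rw [zeroExt_coe] at h1
    have h2 := norm_pos_iff.2 hx
    have h3 := gradNorm_nonneg v
    linarith
  have hu0 := gradNorm_nonneg u
  rw [div_mul_div_comm, one_mul, div_le_div_iff₀ (by positivity) (by positivity), one_mul]
  have h1 : dualNorm Ω (zeroExt q) * X ≤ dualNorm Ω (zeroExt q) * (C * (1 + gradNorm u)) :=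
    mul_le_mul_of_nonneg_left hvle hD.le
  have h2 : 0 < C * (1 + gradNorm u) := by positivity
  nlinarith [mul_lt_mul_of_pos_right hnum h2]
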